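/- Let $L_{\mathrm{cub}}=\{\,a^{n^3}\mid n\ge 0\,\}$ over the one-letter alphabet $\{a\}$. Then $L_{\mathrm{cub}}$ is accepted in real time by some deterministic tree-walking-storage automaton, but it is not accepted (in any amount of time) by any deterministic one-way stack automaton. In particular, there is a language accepted in real time by a deterministic tree-walking-storage automaton that no deterministic one-way stack automaton accepts. Here a deterministic tree-walking-storage automaton is a one-way device with a finite state set $Q$, an initial state, a set $F\subseteq Q$ of accepting states, a finite tree alphabet $\Gamma$, a root symbol $\bot\notin\Gamma$ and, as storage, a finite binary tree with a pointer to one of its nodes. The root of the tree is labelled $\bot$ and all other nodes carry labels from $\Gamma$; initially there is only the root. On input $w$ the machine reads $w$ followed by an endmarker. A step depends on the state, on the next input symbol or on no input symbol, on the label of the current node, and on its type, i.e. whether the node is the root, a left or a right descendant, and whether it has a left and whether it has a right descendant. In a step the machine changes its state and performs one of the following operations: leave the storage and the pointer unchanged; move the pointer to the parent or to an existing left or right descendant; append a missing left or right descendant with a label from $\Gamma$ to the current node and move the pointer there; remove the current node if it is a leaf other than the root and move the pointer to its parent. The partial transition function prescribes only operations that are possible at a node of the given type, and whenever it is defined without input,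 it is undefined for every input symbol (the endmarker included) in the same state, type and label. A word $w$ is accepted if, after $w$ and the endmarker have been read entirely, the machine halts (no transition is defined) in an accepting state. The automaton works in real time if its transition function is undefined without input, so that every step reads one symbol. A deterministic one-way stack automaton is defined in the same way, with the same conventions on input, determinism and acceptance, except that its storage is a linear stack over $\Gamma$ on a bottom symbol $\bot\notin\Gamma$ with a pointer to one of its positions: the machine sees the scanned symbol and whether the pointer is at the top; it may leave the pointer where it is or move it by one position within the stack, it may push a symbol of $\Gamma$ when the pointer is at the top, and pop the top symbol, if that is not $\bot$, when the pointer is at the top; after a push or a pop the pointer is at the new top. Steps without input are permitted. -/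

import Mathlib

namespace TreeStorage

/-- An input symbol: a letter of the alphabet `σ`, or the right endmarker. -/
inductive InSym (σ : Type) where
  | letter (a : σ)
  | endmarker

/-- The input tape for `w`: the letters of `w` followed by the endmarker. -/
def tape {σ : Type} (w : List σ) : List (InSym σ) :=
  w.map InSym.letter ++ [InSym.endmarker]

/-! ### Deterministic tree-walking-storage automata -/

/-- Left or right (descendant). -/
inductive Side where
  | l
  | r
deriving DecidableEq

/-- A node of a binary tree, given by the word over `{l, r}` that leads to it from the root.
The word is stored with its last letter first: the root is `[]`, the `d`-descendant of `P`
is `d :: P`, and the parent of `d :: P` is `P`. -/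
abbrev Node := List Side

/-- The partial labelling of nodes that represents a tree; `none` means that the node does not
exist. `⊥` is the root symbol. All trees that occur in computations arise from the one-node tree
by appending descendants to existing nodes and by removing leaves other than the root, so their
sets of nodes are finite and closed under taking parents, and `⊥` labels exactly the root. -/
abbrev Tree (Γ : Type) := Node → Option (WithBot Γ)

/-- The tree that consists of the root only. -/
def Tree.init (Γ : Type) : Tree Γ := fun P => if P = [] then some ⊥ else none

/-- The type of a node: whether it is the root (`none`), a left or a right descendant, and
whether it has a left and a right descendant. -/
structure NodeType where
  pos : Option Side
  hasL : Bool
  hasR : Bool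

/-- Does a node of this type have a descendant on the given side? -/
def NodeType.has (t : NodeType) : Side → Bool
  | .l => t.hasL
  | .r => t.hasR

/-- The type of the node `P` in the tree `T`. -/
def Tree.nodeType {Γ : Type} (T : Tree Γ) (P : Node) : NodeType where
  pos := P.head?
  hasL := (T (.l :: P)).isSome
  hasR := (T (.r :: P)).isSome

/-- The operations on the tree storage. -/
inductive TreeOp (Γ : Type) where
  | up
  | stay
  | down (d : Side)
  | pop
  | push (x : Γ) (d : Side)

/-- The operations that are possible at a node of type `t`: never move to a node that does not
exist, pop only leaves other than the root, push only descendants that do not exist. -/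
def TreeOp.Allowed {Γ : Type} (t : NodeType) : TreeOp Γ → Prop
  | .up => t.pos ≠ none
  | .stay => True
  | .down d => t.has d = true
  | .pop => t.pos ≠ none ∧ t.hasL = false ∧ t.hasR = false
  | .push _ d => t.has d = false

/-- The effect of an (allowed) operation on the tree and the tree pointer. -/
def TreeOp.run {Γ : Type} : TreeOp Γ → Tree Γ → Node → Tree Γ × Node
  | .up, T, P => (T, P.tail)
  | .stay, T, P => (T, P)
  | .down d, T, P => (T, d :: P)
  | .pop, T, P => (Function.update T P none, P.tail)
  | .push x d, T, P => (Function.update T (d :: P) (some (x : WithBot Γ)), d :: P)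

/-- A deterministic tree-walking-storage automaton with input alphabet `σ`. The second argument
of the partial transition function `δ` is the input symbol that is read, or `none` for a step
without input; `δ` has the value `none` where it is undefined. -/
structure TWSDA (σ : Type) where
  Q : Type
  Γ : Type
  finite_Q : Finite Q
  finite_Γ : Finite Γ
  δ : Q → Option (InSym σ) → NodeType → WithBot Γ → Option (Q × TreeOp Γ)
  q₀ : Q
  F : Set Q
  /-- there is never a choice between reading an input symbol and a step without input -/
  deterministic : ∀ q t x, δ q none t x ≠ none → ∀ a : InSym σ, δ q (some a) t x = none
  /-- the operations prescribed by `δ` are possible -/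
  allowed : ∀ q a t x q' op, δ q a t x = some (q', op) → op.Allowed t

namespace TWSDA

variable {σ : Type}

/-- A configuration: state, unread part of the input, tree, tree pointer. -/
structure Config (M : TWSDA σ) where
  state : M.Q
  input : List (InSym σ)
  tree : Tree M.Γ
  ptr : Node

/-- The initial configuration for the input word `w`. -/
def init (M : TWSDA σ) (w : List σ) : M.Config :=
  ⟨M.q₀, tape w, Tree.init M.Γ, []⟩

/-- One step. Here `a.toList` is the empty word if `a = none`, and the symbol `b` if
`a = some b`. -/
inductive Step (M : TWSDA σ) : M.Config → M.Config → Prop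
  | mk (q q' : M.Q) (a : Option (InSym σ)) (v : List (InSym σ)) (T : Tree M.Γ) (P : Node)
      (x : WithBot M.Γ) (op : TreeOp M.Γ) (label : T P = some x)
      (trans : M.δ q a (T.nodeType P) x = some (q', op)) :
      Step M ⟨q, a.toList ++ v, T, P⟩ ⟨q', v, (op.run T P).1, (op.run T P).2⟩

/-- `M` halts in an accepting state after having read the input and the endmarker entirely. -/
def Accepts (M : TWSDA σ) (w : List σ) : Prop :=
  ∃ (q : M.Q) (T : Tree M.Γ) (P : Node) (x : WithBot M.Γ),
    Relation.ReflTransGen M.Step (M.init w) ⟨q, [], T, P⟩ ∧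
    T P = some x ∧ M.δ q none (T.nodeType P) x = none ∧ q ∈ M.F

/-- The language accepted by `M`. -/
def language (M : TWSDA σ) : Language σ := {w | M.Accepts w}

/-- `M` works in real time: no step is possible without reading an input symbol. -/
def RealTime (M : TWSDA σ) : Prop := ∀ q t x, M.δ q none t x = none

end TWSDA

/-- `L` is accepted in real time by a deterministic tree-walking-storage automaton. -/
def IsRealTimeTWSDALanguage {σ : Type} [Finite σ] (L : Language σ) : Prop :=
  ∃ M : TWSDA σ, M.RealTime ∧ M.language = L

/-! ### Deterministic one-way stack automata -/

/-- The operations on the stack: move the stack pointer one symbol up (towards the top) or down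
(towards the bottom), do not move it, pop the top symbol, or push a symbol on the top. -/
inductive StackOp (Γ : Type) where
  | up
  | stay
  | down
  | pop
  | push (x : Γ)

/-- A stack with its stack pointer. `below` lists the symbols between the bottom symbol `⊥`
(exclusive) and the pointer (inclusive), the scanned one first; if it is empty, the pointer is
at the bottom symbol. `above` lists the symbols above the pointer, the lowest one first. -/
structure Stack (Γ : Type) where
  below : List Γ
  above : List Γ

/-- The scanned symbol. -/
def Stack.scanned {Γ : Type} (S : Stack Γ) : WithBot Γ :=
  match S.below with
  | [] => ⊥
  | x :: _ => (x : WithBot Γ)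

/-- Is the stack pointer at the top of the stack? -/
def Stack.atTop {Γ : Type} (S : Stack Γ) : Bool := S.above.isEmpty

/-- The operations that are possible if the scanned symbol is `x`, and the pointer is at the top
of the stack or not: the pointer moves within the stack, push and pop take place at the top, and
the bottom symbol is never popped. -/
def StackOp.Allowed {Γ : Type} (top : Bool) (x : WithBot Γ) : StackOp Γ → Prop
  | .up => top = false
  | .stay => True
  | .down => x ≠ ⊥
  | .pop => top = true ∧ x ≠ ⊥
  | .push _ => top = true

/-- The effect of an (allowed) operation; the value is irrelevant where the operation is not
possible. -/
def StackOp.run {Γ : Type} : StackOp Γ → Stack Γ → Stack Γ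
  | .up, ⟨b, x :: a⟩ => ⟨x :: b, a⟩
  | .down, ⟨x :: b, a⟩ => ⟨b, x :: a⟩
  | .pop, ⟨_ :: b, a⟩ => ⟨b, a⟩
  | .push x, ⟨b, a⟩ => ⟨x :: b, a⟩
  | _, S => S

/-- A deterministic one-way stack automaton with input alphabet `σ`. The second argument of the
partial transition function `δ` is the input symbol that is read, or `none` for a step without
input; the third one tells whether the stack pointer is at the top; `δ` has the value `none`
where it is undefined. -/
structure DSA (σ : Type) where
  Q : Type
  Γ : Type
  finite_Q : Finite Q
  finite_Γ : Finite Γ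
  δ : Q → Option (InSym σ) → Bool → WithBot Γ → Option (Q × StackOp Γ)
  q₀ : Q
  F : Set Q
  /-- there is never a choice between reading an input symbol and a step without input -/
  deterministic : ∀ q t x, δ q none t x ≠ none → ∀ a : InSym σ, δ q (some a) t x = none
  /-- the operations prescribed by `δ` are possible -/
  allowed : ∀ q a t x q' op, δ q a t x = some (q', op) → op.Allowed t x

namespace DSA

variable {σ : Type}

/-- A configuration: state, unread part of the input, stack with stack pointer. -/
structure Config (M : DSA σ) where
  state : M.Q
  input : List (InSym σ)
  stack : Stack M.Γ

/-- The initial configuration for the input word `w`: the stack holds the bottom symbol only. -/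
def init (M : DSA σ) (w : List σ) : M.Config := ⟨M.q₀, tape w, ⟨[], []⟩⟩

/-- One step. Here `a.toList` is the empty word if `a = none`, and the symbol `b` if
`a = some b`. -/
inductive Step (M : DSA σ) : M.Config → M.Config → Prop
  | mk (q q' : M.Q) (a : Option (InSym σ)) (v : List (InSym σ)) (S : Stack M.Γ)
      (op : StackOp M.Γ) (trans : M.δ q a S.atTop S.scanned = some (q', op)) :
      Step M ⟨q, a.toList ++ v, S⟩ ⟨q', v, op.run S⟩

/-- `M` halts in an accepting state after having read the input and the endmarker entirely. -/
def Accepts (M : DSA σ) (w : List σ) : Prop :=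
  ∃ (q : M.Q) (S : Stack M.Γ),
    Relation.ReflTransGen M.Step (M.init w) ⟨q, [], S⟩ ∧
    M.δ q none S.atTop S.scanned = none ∧ q ∈ M.F

/-- The language accepted by `M`. -/
def language (M : DSA σ) : Language σ := {w | M.Accepts w}

end DSA

/-- `L` is accepted by a deterministic one-way stack automaton (in arbitrary time). -/
def IsDSALanguage {σ : Type} [Finite σ] (L : Language σ) : Prop :=
  ∃ M : DSA σ, M.language = L

/-- The unary language of the words whose lengths are cubes; the letter is the only element
of `Unit`. -/
def cubeLanguage : Language Unit := {w | ∃ n : ℕ, w = List.replicate (n ^ 3) ()}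

end TreeStorage

/-! The stack automaton. On an unbounded unary input a deterministic stack automaton performs one
fixed run, a storage machine without input, and the endmarker is a test that may be applied to any
of its configurations. If a configuration recurs, the run is eventually periodic; then the lengths
that can still be accepted are either bounded or closed under adding a fixed positive number, and
the cubes are neither.

Otherwise only finitely many moments have a stack of any given height, so every height is exceeded
for good at some moment, by a push. By pigeonhole two of these moments agree in the state, the top
symbol and the finite behaviour (`lowerType`) of what lies below, `w` and `z ++ w`
(`nonempty_loop`). From then on the two runs agree, up to the inserted `z`, at the moments when the
pointer is above these lower parts (`shift_next`); only the durations of the visits below may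
differ. Hence the run splits into periods, and the stack contents in period `k` are `b ++ pow z k ++
w` with finitely many `b`. A configuration is determined by state, period, `b` and pointer position,
and none recurs, so the first `K` periods take only `O(K ^ 2)` steps (`T_le`).

If acceptance is possible infinitely often, it is possible in all periods of some arithmetic
progression (`exists_slow`). An accepting moment with the pointer above `w` recurs in every later
period. An accepting moment with the pointer inside `w` is moved to a later period by a second
pigeonhole, on the behaviour (`upperType`) of the upper parts `b ++ pow z i` (`good_add`). So the
`m`-th such moment comes at time `O(m ^ 2)`, while distinct accepting moments give distinct cubes
and at most one letter is read per step: the `m`-th one needs about `m ^ 3` steps.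

The tree automaton. A left spine of length `n` carries right branches of lengths `n - 1, …, 0`. In
one tour every branch is lengthened by one node, the spine receives a new node, and the pointer
returns to the root. With three letters per move and one more letter at the root, a tour reads
exactly `(n + 2) ^ 3 - (n + 1) ^ 3` letters (`walk_phase`), so the pointer completes its returns to
the root exactly at the positive cubes. -/

namespace TreeStorage

/-! ### Locality of stack computations -/

namespace StackRun

variable {Q Γ : Type}

/-- A partial transition function of a stack storage without input. -/
abbrev Trans (Q Γ : Type) := Q → Bool → WithBot Γ → Option (Q × StackOp Γ)

/-- All prescribed operations are possible. -/
def Legal (f : Trans Q Γ) : Prop := ∀ q t x q' op, f q t x = some (q', op) → op.Allowed t x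

/-- No transition is defined. -/
def Halted (f : Trans Q Γ) (c : Q × Stack Γ) : Prop := f c.1 c.2.atTop c.2.scanned = none

/-- One step of the storage machine; a halted configuration is left unchanged. -/
def step (f : Trans Q Γ) (c : Q × Stack Γ) : Q × Stack Γ :=
  match f c.1 c.2.atTop c.2.scanned with
  | some (q', op) => (q', op.run c.2)
  | none => c

/-- The whole contents of a stack, the topmost symbol first. -/
def word (S : Stack Γ) : List Γ := S.above.reverse ++ S.below

/-- A step sees only the scanned symbol and whether the pointer is at the top, so everything below
the scanned symbol is irrelevant and stays intact. The contents change only by push and pop, which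
start and end with the pointer at the top. -/
theorem step_visible {f : Trans Q Γ} (hf : Legal f) (q : Q) {b : List Γ} (hb : b ≠ [])
    (a : List Γ) : ∃ q' b' a', (∀ v, step f (q, ⟨b ++ v, a⟩) = (q', ⟨b' ++ v, a'⟩)) ∧
      (a ≠ [] ∨ a' ≠ [] → a'.reverse ++ b' = a.reverse ++ b) := by
  obtain ⟨x, b, rfl⟩ := List.exists_cons_of_ne_nil hb
  have key : ∀ v, step f (q, ⟨x :: b ++ v, a⟩) = match f q a.isEmpty (x : WithBot Γ) with
      | some (q', op) => (q', op.run ⟨x :: b ++ v, a⟩)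
      | none => (q, ⟨x :: b ++ v, a⟩) := fun v => rfl
  simp only [key]
  rcases h : f q a.isEmpty (x : WithBot Γ) with _ | ⟨q', op⟩
  · exact ⟨q, x :: b, a, fun v => rfl, fun _ => rfl⟩
  · have hal := hf _ _ _ _ _ h
    refine ⟨q', ?_⟩
    cases op with
    | up =>
      cases a with
      | nil => exact ⟨x :: b, [], fun v => rfl, fun _ => rfl⟩
      | cons y a => exact ⟨y :: x :: b, a, fun v => rfl, fun _ => by simp⟩
    | stay => exact ⟨x :: b, a, fun v => rfl, fun _ => rfl⟩
    | down => exact ⟨b, x :: a, fun v => rfl, fun _ => by simp⟩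
    | pop =>
      refine ⟨b, a, fun v => rfl, fun ha => ?_⟩
      have : a.isEmpty = true := hal.1
      simp_all
    | push y =>
      refine ⟨y :: x :: b, a, fun v => rfl, fun ha => ?_⟩
      have : a.isEmpty = true := hal
      simp_all

theorem run_low {op : StackOp Γ} {b : List Γ}
    (h : op.Allowed false (Stack.scanned (⟨b, []⟩ : Stack Γ))) (a : List Γ) :
    (∃ b' a', a'.reverse ++ b' = a.reverse ++ b ∧
        ∀ y, y ≠ [] → op.run ⟨b, a ++ y⟩ = ⟨b', a' ++ y⟩) ∨
      (a = [] ∧ ∀ x t, op.run ⟨b, x :: t⟩ = ⟨x :: b, t⟩) := by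
  cases op with
  | up =>
    cases a with
    | nil => exact Or.inr ⟨rfl, fun x t => rfl⟩
    | cons z a => exact Or.inl ⟨z :: b, a, by simp, fun y _ => rfl⟩
  | stay => exact Or.inl ⟨b, a, rfl, fun y _ => rfl⟩
  | down =>
    cases b with
    | nil => exact absurd rfl h
    | cons z b => exact Or.inl ⟨b, z :: a, by simp, fun y _ => rfl⟩
  | pop => exact absurd h.1 (by simp)
  | push y => exact absurd h (by simp [StackOp.Allowed])

/-- With something stored above, the pointer is not at the top, so push and pop are excluded. The
last alternative is the move up out of the lower part. -/
theorem step_low {f : Trans Q Γ} (hf : Legal f) (q : Q) (b a : List Γ) :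
    ∃ q', (∃ b' a', a'.reverse ++ b' = a.reverse ++ b ∧
        ∀ y, y ≠ [] → step f (q, ⟨b, a ++ y⟩) = (q', ⟨b', a' ++ y⟩)) ∨
      (a = [] ∧ ∀ x t, step f (q, ⟨b, x :: t⟩) = (q', ⟨x :: b, t⟩)) := by
  have key : ∀ y, y ≠ [] → step f (q, ⟨b, a ++ y⟩) =
      match f q false (Stack.scanned ⟨b, []⟩) with
      | some (q', op) => (q', op.run ⟨b, a ++ y⟩)
      | none => (q, ⟨b, a ++ y⟩) := by
    intro y hy
    have : Stack.atTop (⟨b, a ++ y⟩ : Stack Γ) = false := by simp [Stack.atTop, hy]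
    simp only [step, this]
    rfl
  rcases h : f q false (Stack.scanned ⟨b, []⟩) with _ | ⟨q', op⟩
  · exact ⟨q, Or.inl ⟨b, a, rfl, fun y hy => by rw [key y hy, h]⟩⟩
  · refine ⟨q', ?_⟩
    rcases run_low (hf _ _ _ _ _ h) a with ⟨b', a', hw, H⟩ | ⟨rfl, H⟩
    · exact Or.inl ⟨b', a', hw, fun y hy => by rw [key y hy, h, ← H y hy]⟩
    · refine Or.inr ⟨rfl, fun x t => ?_⟩
      have := key (x :: t) (by simp)
      simp only [List.nil_append] at this
      rw [this, h, ← H x t]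

/-- After `n` steps from position `a.reverse ++ b` within a lower part of the stack, the pointer
is still in the lower part, whatever is stored above. -/
def LowAt (f : Trans Q Γ) (q : Q) (b a : List Γ) (n : ℕ) (q' : Q) (b' a' : List Γ) : Prop :=
  a'.reverse ++ b' = a.reverse ++ b ∧
    ∀ y, y ≠ [] → (step f)^[n] (q, ⟨b, a ++ y⟩) = (q', ⟨b', a' ++ y⟩)

/-- After `n` steps the pointer leaves the lower part of the stack for the first time. -/
def LowExit (f : Trans Q Γ) (q : Q) (b a : List Γ) (n : ℕ) (r : Q) : Prop :=
  (∀ m < n, ∃ q' b' a', LowAt f q b a m q' b' a') ∧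
    ∀ x t, (step f)^[n] (q, ⟨b, a ++ x :: t⟩) = (r, ⟨x :: (a.reverse ++ b), t⟩)

/-- Until the pointer leaves the lower part, the machine knows of the upper part only that it is
nonempty; hence both alternatives are uniform in what is stored above. -/
theorem low_dichotomy {f : Trans Q Γ} (hf : Legal f) (q : Q) (b a : List Γ) (n : ℕ) :
    (∀ m ≤ n, ∃ q' b' a', LowAt f q b a m q' b' a') ∨
      ∃ k ≤ n, 0 < k ∧ ∃ r, LowExit f q b a k r := by
  induction n with
  | zero =>
    refine Or.inl fun m hm => ?_
    obtain rfl : m = 0 := by omega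
    exact ⟨q, b, a, rfl, fun y _ => rfl⟩
  | succ n ih =>
    rcases ih with ih | ⟨k, hk, h0, r, h⟩
    · obtain ⟨q₁, b₁, a₁, hw, h₁⟩ := ih n le_rfl
      obtain ⟨q', ⟨b', a', hw', h'⟩ | ⟨rfl, h'⟩⟩ := step_low hf q₁ b₁ a₁
      · refine Or.inl fun m hm => ?_
        rcases Nat.lt_or_eq_of_le hm with hm | rfl
        · exact ih m (by omega)
        · exact ⟨q', b', a', hw'.trans hw, fun y hy => by
            rw [Function.iterate_succ_apply', h₁ y hy, h' y hy]⟩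
      · refine Or.inr ⟨n + 1, le_rfl, by omega, q', fun m hm => ih m (by omega), fun x t => ?_⟩
        rw [Function.iterate_succ_apply', h₁ _ (by simp), List.nil_append, h' x t, ← hw]
        simp
    · exact Or.inr ⟨k, by omega, h0, r, h⟩

/-- After `n` steps the pointer is inside the upper part of the stack, below its top. -/
def HighAt (f : Trans Q Γ) (q : Q) (b a : List Γ) (n : ℕ) (q' : Q) (b' a' : List Γ) : Prop :=
  b' ≠ [] ∧ a' ≠ [] ∧ a'.reverse ++ b' = a.reverse ++ b ∧
    ∀ v, (step f)^[n] (q, ⟨b ++ v, a⟩) = (q', ⟨b' ++ v, a'⟩)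

/-- The counterpart of `low_dichotomy` for an upper part, which can be left in two ways: down into
`v`, or by reaching the top, after which its contents may change. -/
theorem high_trichotomy {f : Trans Q Γ} (hf : Legal f) (q : Q) {b a : List Γ} (hb : b ≠ [])
    (ha : a ≠ []) (n : ℕ) :
    (∀ m ≤ n, ∃ q' b' a', HighAt f q b a m q' b' a') ∨
      ∃ k ≤ n, 0 < k ∧ (∀ m < k, ∃ q' b' a', HighAt f q b a m q' b' a') ∧
        ∃ r, (∀ v, (step f)^[k] (q, ⟨b ++ v, a⟩) = (r, ⟨v, b.reverse ++ a⟩)) ∨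
          (∀ v, (step f)^[k] (q, ⟨b ++ v, a⟩) = (r, ⟨a.reverse ++ b ++ v, []⟩)) := by
  induction n with
  | zero =>
    refine Or.inl fun m hm => ?_
    obtain rfl : m = 0 := by omega
    exact ⟨q, b, a, hb, ha, rfl, fun y => rfl⟩
  | succ n ih =>
    rcases ih with ih | ⟨k, hk, h⟩
    · obtain ⟨q₁, b₁, a₁, hb₁, ha₁, hw, h₁⟩ := ih n le_rfl
      obtain ⟨q', b', a', h', hw'⟩ := step_visible hf q₁ hb₁ a₁
      replace hw' := (hw' (Or.inl ha₁)).trans hw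
      have hs : ∀ v, (step f)^[n + 1] (q, ⟨b ++ v, a⟩) = (q', ⟨b' ++ v, a'⟩) := fun v => by
        rw [Function.iterate_succ_apply', h₁, h']
      by_cases hb' : b' = []
      · subst hb'
        refine Or.inr ⟨n + 1, le_rfl, by omega, fun m hm => ih m (by omega), q', Or.inl ?_⟩
        intro v
        have : a' = b.reverse ++ a := by
          have := congrArg List.reverse hw'
          simpa using this
        rw [hs, this, List.nil_append]
      · by_cases ha' : a' = []
        · subst ha'
          refine Or.inr ⟨n + 1, le_rfl, by omega, fun m hm => ih m (by omega), q', Or.inr ?_⟩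
          intro v
          rw [hs, ← hw']
          simp
        · refine Or.inl fun m hm => ?_
          rcases Nat.lt_or_eq_of_le hm with hm | rfl
          · exact ih m (by omega)
          · exact ⟨q', b', a', hb', ha', hw', hs⟩
    · exact Or.inr ⟨k, by omega, h⟩

end StackRun

end TreeStorage

/-! ### Finite behaviour types and the exchange of stack parts -/

namespace TreeStorage

namespace StackRun

variable {Q Γ : Type}

/-- The machine halts in a state of `F` after `n` steps. -/
def AcceptsIn (g : Trans Q Γ) (F : Set Q) (n : ℕ) (c : Q × Stack Γ) : Prop :=
  Halted g ((step g)^[n] c) ∧ ((step g)^[n] c).1 ∈ F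

/-- The machine halts in a state of `F`. -/
def AcceptsFrom (g : Trans Q Γ) (F : Set Q) (c : Q × Stack Γ) : Prop := ∃ n, AcceptsIn g F n c

theorem acceptsIn_iterate {g : Trans Q Γ} {F : Set Q} {n k : ℕ} (hk : k ≤ n) {c : Q × Stack Γ} :
    AcceptsIn g F (n - k) ((step g)^[k] c) ↔ AcceptsIn g F n c := by
  unfold AcceptsIn
  rw [← Function.iterate_add_apply, Nat.sub_add_cancel hk]

theorem AcceptsFrom.of_iterate {g : Trans Q Γ} {F : Set Q} {k : ℕ} {c : Q × Stack Γ}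
    (h : AcceptsFrom g F ((step g)^[k] c)) : AcceptsFrom g F c := by
  obtain ⟨n, hn⟩ := h
  refine ⟨n + k, ?_⟩
  unfold AcceptsIn at *
  rwa [Function.iterate_add_apply]

theorem halted_low {f : Trans Q Γ} {q : Q} {b a y y' : List Γ} (hy : y ≠ []) (hy' : y' ≠ [])
    (h : Halted f (q, ⟨b, a ++ y⟩)) : Halted f (q, ⟨b, a ++ y'⟩) := by
  have e : (a ++ y).isEmpty = (a ++ y').isEmpty := by
    rw [List.isEmpty_eq_false_iff.2 (by simp [hy]), List.isEmpty_eq_false_iff.2 (by simp [hy'])]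
  change f q (a ++ y').isEmpty (Stack.scanned ⟨b, []⟩) = none
  rw [← e]
  exact h

theorem halted_visible {f : Trans Q Γ} {q : Q} {b a : List Γ} (hb : b ≠ []) (v v' : List Γ)
    (h : Halted f (q, ⟨b ++ v, a⟩)) : Halted f (q, ⟨b ++ v', a⟩) := by
  obtain ⟨x, b, rfl⟩ := List.exists_cons_of_ne_nil hb
  exact h

/-- The behaviour of a lower part `w` of the stack: how it is left in the two phases, from which
states the machine accepts within it, and from which states it accepts at its top. -/
def lowerType (f g : Trans Q Γ) (F : Set Q) (w : List Γ) :
    Set (Q × Q) × Set (Q × Q) × Set Q × Set Q :=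
  ({p | ∃ n, LowExit f p.1 w [] n p.2}, {p | ∃ n, LowExit g p.1 w [] n p.2},
    {q | ∀ y, y ≠ [] → AcceptsFrom g F (q, ⟨w, y⟩)}, {q | AcceptsFrom g F (q, ⟨w, []⟩)})

theorem exists_lowExit_of_lowerType {f g : Trans Q Γ} {F : Set Q} {w w' : List Γ}
    (h : lowerType f g F w = lowerType f g F w') {q r : Q} {n : ℕ} (hn : LowExit f q w [] n r) :
    ∃ n, LowExit f q w' [] n r := by
  have : (q, r) ∈ (lowerType f g F w).1 := ⟨n, hn⟩
  rwa [h] at this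

/-- Steps above `w` are copied literally. A visit to `w` either leaves it, which the type reproduces
as one block with possibly another duration, or ends the computation there, which the type records.
If the stack has shrunk to `w` with the pointer at its top, the last component of the type takes
over. -/
theorem acceptsFrom_lower {f g : Trans Q Γ} (hg : Legal g) {F : Set Q} {w w' : List Γ}
    (h : lowerType f g F w = lowerType f g F w') (n : ℕ) :
    ∀ q b a, AcceptsIn g F n (q, ⟨b ++ w, a⟩) → AcceptsFrom g F (q, ⟨b ++ w', a⟩) := by
  induction n using Nat.strong_induction_on with
  | _ n ih =>
  intro q b a hn
  rcases eq_or_ne b [] with rfl | hb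
  · cases a with
    | nil =>
      have : q ∈ (lowerType f g F w).2.2.2 := ⟨n, hn⟩
      rwa [h] at this
    | cons x t =>
      rcases low_dichotomy hg q w [] n with H | ⟨k, hk, h0, r, H⟩
      · obtain ⟨q', b', a', -, h'⟩ := H n le_rfl
        have : q ∈ (lowerType f g F w).2.2.1 := by
          intro y hy
          refine ⟨n, ?_⟩
          have e := h' _ (List.cons_ne_nil x t)
          have e' := h' y hy
          rw [List.nil_append] at e e' hn
          unfold AcceptsIn at *
          rw [e] at hn
          rw [e']
          exact ⟨halted_low (by simp) hy hn.1, hn.2⟩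
        rw [h] at this
        exact this _ (by simp)
      · have hT : (q, r) ∈ (lowerType f g F w).2.1 := ⟨k, H⟩
        rw [h] at hT
        obtain ⟨k', H'⟩ := hT
        have e := H.2 x t
        have e' := H'.2 x t
        simp only [List.nil_append, List.reverse_nil] at e e' hn ⊢
        rw [← acceptsIn_iterate hk, e] at hn
        refine AcceptsFrom.of_iterate (k := k') ?_
        rw [e']
        exact ih (n - k) (by omega) r [x] t hn
  · cases n with
    | zero => exact ⟨0, halted_visible hb _ _ hn.1, hn.2⟩
    | succ n =>
      obtain ⟨q', b', a', h', -⟩ := step_visible hg q hb a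
      rw [← acceptsIn_iterate (k := 1) (by omega), Function.iterate_one, h'] at hn
      refine AcceptsFrom.of_iterate (k := 1) ?_
      rw [Function.iterate_one, h']
      exact ih _ (by omega) _ _ _ hn

/-- In this configuration no step without input is possible, and the machine accepts when it reads
the endmarker (by `e`) and continues without input (by `g`). -/
def EndAccepts (e g : Trans Q Γ) (F : Set Q) (c : Q × Stack Γ) : Prop :=
  Halted g c ∧ ¬ Halted e c ∧ AcceptsFrom g F (step e c)

theorem endAccepts_lower {f e g : Trans Q Γ} (he : Legal e) (hg : Legal g) {F : Set Q}
    {w w' : List Γ} (h : lowerType f g F w = lowerType f g F w') {q : Q} {b a : List Γ}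
    (hb : b ≠ []) (hc : EndAccepts e g F (q, ⟨b ++ w, a⟩)) :
    EndAccepts e g F (q, ⟨b ++ w', a⟩) := by
  obtain ⟨h₁, h₂, n, h₃⟩ := hc
  refine ⟨halted_visible hb _ _ h₁, fun H => h₂ (halted_visible hb _ _ H), ?_⟩
  obtain ⟨q', b', a', h', -⟩ := step_visible he q hb a
  rw [h'] at h₃ ⊢
  exact acceptsFrom_lower hg h n _ _ _ h₃

/-- `n` steps lead from `c` to `c'`, and the pointer is never at the top. -/
def Inside (f : Trans Q Γ) (n : ℕ) (c c' : Q × Stack Γ) : Prop :=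
  (step f)^[n] c = c' ∧ ∀ m ≤ n, ((step f)^[m] c).2.above ≠ []

theorem Inside.trans {f : Trans Q Γ} {m n : ℕ} {c c' c'' : Q × Stack Γ} (h : Inside f m c c')
    (h' : Inside f n c' c'') : Inside f (n + m) c c'' := by
  obtain ⟨rfl, h₂⟩ := h
  obtain ⟨h₃, h₄⟩ := h'
  refine ⟨by rw [Function.iterate_add_apply, h₃], fun k hk => ?_⟩
  rcases le_or_gt k m with hkm | hkm
  · exact h₂ k hkm
  · have := h₄ (k - m) (by omega)
    rwa [← Function.iterate_add_apply, Nat.sub_add_cancel hkm.le] at this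

theorem Inside.drop {f : Trans Q Γ} {k n : ℕ} {c c' : Q × Stack Γ} (h : Inside f n c c')
    (hk : k ≤ n) : Inside f (n - k) ((step f)^[k] c) c' := by
  refine ⟨?_, fun m hm => ?_⟩
  · rw [← Function.iterate_add_apply, Nat.sub_add_cancel hk, h.1]
  · rw [← Function.iterate_add_apply]
    exact h.2 _ (by omega)

/-- The behaviour of an upper part `y` of the stack (its lowest symbol first) as long as its top is
not reached: how it is left downwards when it is entered from below in the two phases, how it is
left downwards from its top, and in the last phase how its top is reached and when the machine
accepts within it. -/
def upperType (f g : Trans Q Γ) (F : Set Q) (y : List Γ) :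
    Set (Q × Q) × Set (Q × Q) × Set (Q × Q) × Set (Q × Q) × Set Q :=
  ({p | ∀ v, ∃ n, Inside f n (p.1, StackOp.up.run ⟨v, y⟩) (p.2, ⟨v, y⟩)},
    {p | ∀ v, ∃ n, Inside f n (step f (p.1, ⟨y.reverse ++ v, []⟩)) (p.2, ⟨v, y⟩)},
    {p | ∀ v, ∃ n, (step g)^[n] (p.1, StackOp.up.run ⟨v, y⟩) = (p.2, ⟨v, y⟩)},
    {p | ∀ v, ∃ n, (step g)^[n] (p.1, StackOp.up.run ⟨v, y⟩) = (p.2, ⟨y.reverse ++ v, []⟩)},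
    {s | ∀ v, AcceptsFrom g F (s, StackOp.up.run ⟨v, y⟩)})

section Upper

variable {f e g : Trans Q Γ} {F : Set Q} {y y' v : List Γ}

/-- The computation alternates between `v` and the upper part, hence the joint induction: stretches
within `v` are copied, visits to `y` are replaced by the type. Once the top is reached the upper
part may be rewritten and the type says nothing more; from there `hT` is used. -/
theorem acceptsFrom_upper (hg : Legal g) (hy : y ≠ []) (hy' : y' ≠ [])
    (h : upperType f g F y = upperType f g F y')
    (hT : ∀ r, AcceptsFrom g F (r, ⟨y.reverse ++ v, []⟩) →
      AcceptsFrom g F (r, ⟨y'.reverse ++ v, []⟩)) (n : ℕ) :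
    (∀ s b a, a.reverse ++ b = v → AcceptsIn g F n (s, ⟨b, a ++ y⟩) →
        AcceptsFrom g F (s, ⟨b, a ++ y'⟩)) ∧
      ∀ s, AcceptsIn g F n (s, StackOp.up.run ⟨v, y⟩) →
        AcceptsFrom g F (s, StackOp.up.run ⟨v, y'⟩) := by
  induction n using Nat.strong_induction_on with
  | _ n ih =>
  constructor
  · intro s b a hv hn
    rcases low_dichotomy hg s b a n with H | ⟨k, hk, h0, r, H⟩
    · obtain ⟨q', b', a', -, h'⟩ := H n le_rfl
      refine ⟨n, ?_⟩
      unfold AcceptsIn at *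
      rw [h' _ hy] at hn
      rw [h' _ hy']
      exact ⟨halted_low hy hy' hn.1, hn.2⟩
    · rw [← acceptsIn_iterate hk] at hn
      refine AcceptsFrom.of_iterate (k := k) ?_
      obtain ⟨x, t, rfl⟩ := List.exists_cons_of_ne_nil hy
      obtain ⟨x', t', rfl⟩ := List.exists_cons_of_ne_nil hy'
      rw [H.2, hv] at hn ⊢
      exact (ih (n - k) (by omega)).2 r hn
  · intro s hn
    have top : ∀ r, (s, r) ∈ (upperType f g F y).2.2.2.1 →
        AcceptsFrom g F (r, ⟨y.reverse ++ v, []⟩) →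
        AcceptsFrom g F (s, StackOp.up.run ⟨v, y'⟩) := by
      intro r hr ha
      rw [h] at hr
      obtain ⟨k, hk⟩ := hr v
      refine AcceptsFrom.of_iterate (k := k) ?_
      rw [hk]
      exact hT r ha
    obtain ⟨x, t, rfl⟩ := List.exists_cons_of_ne_nil hy
    rcases eq_or_ne t [] with rfl | ht
    -- The upper part has only one symbol, so entering it already means reaching the top.
    · exact top s (fun v => ⟨0, rfl⟩) ⟨n, hn⟩
    · rcases high_trichotomy hg s (b := [x]) (by simp) ht n with
        H | ⟨k, hk, h0, -, r, H | H⟩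
      · obtain ⟨q', b', a', hb', ha', -, h'⟩ := H n le_rfl
        have : s ∈ (upperType f g F (x :: t)).2.2.2.2 := by
          intro v'
          refine ⟨n, ?_⟩
          have e : (step g)^[n] (s, StackOp.up.run ⟨v, x :: t⟩) = (q', ⟨b' ++ v, a'⟩) := h' v
          have e' : (step g)^[n] (s, StackOp.up.run ⟨v', x :: t⟩) = (q', ⟨b' ++ v', a'⟩) := h' v'
          unfold AcceptsIn at *
          rw [e] at hn
          rw [e']
          exact ⟨halted_visible hb' _ _ hn.1, hn.2⟩
        rw [h] at this
        exact this v
      · have hr : (s, r) ∈ (upperType f g F (x :: t)).2.2.1 := fun v => ⟨k, H v⟩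
        rw [h] at hr
        obtain ⟨k', H'⟩ := hr v
        have e : (step g)^[k] (s, StackOp.up.run ⟨v, x :: t⟩) = (r, ⟨v, x :: t⟩) := H v
        rw [← acceptsIn_iterate hk, e] at hn
        refine AcceptsFrom.of_iterate (k := k') ?_
        rw [H']
        exact (ih (n - k) (by omega)).1 r v [] rfl hn
      · have e : ∀ v, (step g)^[k] (s, StackOp.up.run ⟨v, x :: t⟩) =
            (r, ⟨(x :: t).reverse ++ v, []⟩) := fun v => by
          rw [List.reverse_cons]; exact H v
        refine top r (fun v => ⟨k, e v⟩) ⟨n - k, ?_⟩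
        rwa [← acceptsIn_iterate hk, e] at hn

theorem endAccepts_upper (he : Legal e) (hg : Legal g) (hy : y ≠ []) (hy' : y' ≠ [])
    (h : upperType f g F y = upperType f g F y')
    (hT : ∀ r, AcceptsFrom g F (r, ⟨y.reverse ++ v, []⟩) →
      AcceptsFrom g F (r, ⟨y'.reverse ++ v, []⟩)) {s : Q} {b a : List Γ}
    (hv : a.reverse ++ b = v) (hc : EndAccepts e g F (s, ⟨b, a ++ y⟩)) :
    EndAccepts e g F (s, ⟨b, a ++ y'⟩) := by
  obtain ⟨h₁, h₂, n, h₃⟩ := hc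
  refine ⟨halted_low hy hy' h₁, fun H => h₂ (halted_low hy' hy H), ?_⟩
  obtain ⟨q', ⟨b', a', hw, h'⟩ | ⟨rfl, h'⟩⟩ := step_low he s b a
  · rw [h' _ hy] at h₃
    rw [h' _ hy']
    exact (acceptsFrom_upper hg hy hy' h hT n).1 _ _ _ (hw.trans hv) h₃
  · obtain ⟨x, t, rfl⟩ := List.exists_cons_of_ne_nil hy
    obtain ⟨x', t', rfl⟩ := List.exists_cons_of_ne_nil hy'
    rw [List.nil_append, h'] at h₃ ⊢
    rw [List.reverse_nil, List.nil_append] at hv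
    rw [hv] at h₃ ⊢
    exact (acceptsFrom_upper hg hy hy' h hT n).2 _ h₃

theorem inside_low {q q' : Q} {b b' a a' : List Γ} {n : ℕ}
    (H : ∀ m ≤ n, ∃ q' b' a', LowAt f q b a m q' b' a') (h : LowAt f q b a n q' b' a')
    (hy : y ≠ []) : Inside f n (q, ⟨b, a ++ y⟩) (q', ⟨b', a' ++ y⟩) := by
  refine ⟨h.2 y hy, fun m hm => ?_⟩
  obtain ⟨q₁, b₁, a₁, -, h₁⟩ := H m hm
  rw [h₁ y hy]
  simp [hy]

/-- The same alternation for a stretch that avoids the top and ends within `v`: every visit to the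
upper part must then leave it downwards, so the first component of the type suffices. -/
theorem inside_upper (hf : Legal f) (hy : y ≠ []) (hy' : y' ≠ [])
    (h : upperType f g F y = upperType f g F y') {s : Q} {b a : List Γ}
    (hv : a.reverse ++ b = v) (n : ℕ) :
    (∀ q b₀ a₀, a₀.reverse ++ b₀ = v → Inside f n (q, ⟨b₀, a₀ ++ y⟩) (s, ⟨b, a ++ y⟩) →
        ∃ k, Inside f k (q, ⟨b₀, a₀ ++ y'⟩) (s, ⟨b, a ++ y'⟩)) ∧
      ∀ q, Inside f n (q, StackOp.up.run ⟨v, y⟩) (s, ⟨b, a ++ y⟩) →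
        ∃ k, Inside f k (q, StackOp.up.run ⟨v, y'⟩) (s, ⟨b, a ++ y'⟩) := by
  induction n using Nat.strong_induction_on with
  | _ n ih =>
  constructor
  · intro q b₀ a₀ hv₀ hn
    rcases low_dichotomy hf q b₀ a₀ n with H | ⟨k, hk, h0, r, H⟩
    · obtain ⟨q', b', a', h'⟩ := H n le_rfl
      have e := hn.1
      rw [h'.2 _ hy] at e
      simp only [Prod.mk.injEq, Stack.mk.injEq, List.append_cancel_right_eq] at e
      obtain ⟨rfl, rfl, rfl⟩ := e
      exact ⟨n, inside_low H h' hy'⟩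
    · have e : ∀ y, y ≠ [] →
          (step f)^[k] (q, ⟨b₀, a₀ ++ y⟩) = (r, StackOp.up.run ⟨v, y⟩) := by
        intro y hy
        obtain ⟨x, t, rfl⟩ := List.exists_cons_of_ne_nil hy
        rw [H.2, hv₀]; rfl
      have hd := hn.drop hk
      rw [e y hy] at hd
      obtain ⟨j, hj⟩ := (ih (n - k) (by omega)).2 r hd
      have ht : Inside f k (q, ⟨b₀, a₀ ++ y'⟩) (r, StackOp.up.run ⟨v, y'⟩) := by
        refine ⟨e y' hy', fun m hm => ?_⟩
        rcases Nat.lt_or_eq_of_le hm with hm | rfl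
        · obtain ⟨q₁, b₁, a₁, -, h₁⟩ := H.1 m hm
          rw [h₁ y' hy']
          simp [hy']
        · rw [e y' hy']
          exact hj.2 0 (by omega)
      exact ⟨_, ht.trans hj⟩
  · intro q hn
    obtain ⟨x, t, rfl⟩ := List.exists_cons_of_ne_nil hy
    rcases eq_or_ne t [] with rfl | ht
    · exact absurd rfl (hn.2 0 (by omega))
    · rcases high_trichotomy hf q (b := [x]) (by simp) ht n with H | ⟨k, hk, h0, H', r, H | H⟩
      · obtain ⟨q', b', a', hb', -, -, h'⟩ := H n le_rfl
        have e : (step f)^[n] (q, StackOp.up.run ⟨v, x :: t⟩) = (q', ⟨b' ++ v, a'⟩) := h' v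
        have e' := hn.1
        rw [e] at e'
        simp only [Prod.mk.injEq, Stack.mk.injEq] at e'
        have h₁ := congrArg List.length e'.2.1
        -- The final pointer position is within `v`, so the run cannot still be inside the upper
        -- part.
        have h₂ := congrArg List.length hv
        have h₃ := List.length_pos_of_ne_nil hb'
        simp only [List.length_append, List.length_reverse] at h₁ h₂
        omega
      · have e : ∀ v, (step f)^[k] (q, StackOp.up.run ⟨v, x :: t⟩) = (r, ⟨v, x :: t⟩) := H
        have hr : (q, r) ∈ (upperType f g F (x :: t)).1 := by
          refine fun v => ⟨k, e v, fun m hm => ?_⟩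
          rcases Nat.lt_or_eq_of_le hm with hm | rfl
          · obtain ⟨q₁, b₁, a₁, -, ha₁, -, h₁⟩ := H' m hm
            have e₁ : (step f)^[m] (q, StackOp.up.run ⟨v, x :: t⟩) = (q₁, ⟨b₁ ++ v, a₁⟩) := h₁ v
            rwa [e₁]
          · rw [e]
            exact List.cons_ne_nil x t
        rw [h] at hr
        obtain ⟨k', hk'⟩ := hr v
        have hd := hn.drop hk
        rw [e] at hd
        obtain ⟨j, hj⟩ := (ih (n - k) (by omega)).1 r v [] rfl hd
        exact ⟨_, hk'.trans hj⟩
      · have := hn.2 k hk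
        have e : (step f)^[k] (q, StackOp.up.run ⟨v, x :: t⟩) = (r, ⟨t.reverse ++ [x] ++ v, []⟩) :=
          H v
        rw [e] at this
        exact absurd rfl this

/-- The descent from the top to the first arrival in `v` is given by the second component of the
type; `inside_upper` handles the rest. -/
theorem inside_upper_of_top (hf : Legal f) (hy : y ≠ []) (hy' : y' ≠ [])
    (h : upperType f g F y = upperType f g F y') {q s : Q} {b a : List Γ}
    (hv : a.reverse ++ b = v) {n : ℕ}
    (hn : Inside f n (step f (q, ⟨y.reverse ++ v, []⟩)) (s, ⟨b, a ++ y⟩)) :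
    ∃ k, Inside f k (step f (q, ⟨y'.reverse ++ v, []⟩)) (s, ⟨b, a ++ y'⟩) := by
  have fin : ∀ k r, k ≤ n →
      (∀ v, Inside f k (step f (q, ⟨y.reverse ++ v, []⟩)) (r, ⟨v, y⟩)) →
      ∃ k, Inside f k (step f (q, ⟨y'.reverse ++ v, []⟩)) (s, ⟨b, a ++ y'⟩) := by
    intro k r hk H
    have hr : (q, r) ∈ (upperType f g F y).2.1 := fun v => ⟨k, H v⟩
    rw [h] at hr
    obtain ⟨k', H'⟩ := hr v
    have hd := hn.drop hk
    rw [(H v).1] at hd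
    obtain ⟨j, hj⟩ := (inside_upper hf hy hy' h hv (n - k)).1 r v [] rfl hd
    exact ⟨_, H'.trans hj⟩
  obtain ⟨q', b', a', h', hw⟩ := step_visible hf q (b := y.reverse) (by simpa using hy) []
  simp only [h'] at fin
  rw [h'] at hn
  have ha' : a' ≠ [] := hn.2 0 (by omega)
  have hw' : b'.reverse ++ a' = y := by simpa using congrArg List.reverse (hw (Or.inr ha'))
  rcases eq_or_ne b' [] with rfl | hb'
  · refine fin 0 q' (by omega) fun v => ?_
    rw [List.reverse_nil, List.nil_append] at hw'
    subst hw'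
    refine ⟨rfl, fun m hm => ?_⟩
    obtain rfl : m = 0 := by omega
    exact hy
  · rcases high_trichotomy hf q' hb' ha' n with H | ⟨k, hk, h0, H', r, H | H⟩
    · obtain ⟨q₂, b₂, a₂, hb₂, -, -, h₂⟩ := H n le_rfl
      have e := hn.1
      rw [h₂] at e
      simp only [Prod.mk.injEq, Stack.mk.injEq] at e
      have h₁ := congrArg List.length e.2.1
      have h₂ := congrArg List.length hv
      have h₃ := List.length_pos_of_ne_nil hb₂
      simp only [List.length_append, List.length_reverse] at h₁ h₂
      omega
    · refine fin k r hk fun v => ⟨by rw [H, hw'], fun m hm => ?_⟩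
      rcases Nat.lt_or_eq_of_le hm with hm | rfl
      · obtain ⟨q₁, b₁, a₁, -, ha₁, -, h₁⟩ := H' m hm
        rwa [h₁]
      · rw [H, hw']
        exact hy
    · have := hn.2 k hk
      rw [H] at this
      exact absurd rfl this

end Upper

end StackRun

end TreeStorage

/-! ### Growth of the stack and a repeated behaviour -/

namespace TreeStorage

namespace StackRun

variable {Q Γ : Type}

theorem word_step {f : Trans Q Γ} (hf : Legal f) (c : Q × Stack Γ) :
    word (step f c).2 = word c.2 ∨ (step f c).2.above = [] ∧
      ((∃ x, word (step f c).2 = x :: word c.2) ∨ ∃ x, word c.2 = x :: word (step f c).2) := by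
  obtain ⟨q, b, a⟩ := c
  unfold step
  dsimp only
  rcases h : f q (Stack.atTop ⟨b, a⟩) (Stack.scanned ⟨b, a⟩) with _ | ⟨q', op⟩
  · exact Or.inl rfl
  · have hal := hf _ _ _ _ _ h
    dsimp only
    cases op with
    | up => cases a <;> simp [StackOp.run, word]
    | stay => exact Or.inl rfl
    | down => cases b <;> simp [StackOp.run, word]
    | pop =>
      obtain rfl : a = [] := List.isEmpty_iff.1 hal.1
      cases b with
      | nil => exact Or.inl rfl
      | cons x b => exact Or.inr ⟨rfl, Or.inr ⟨x, rfl⟩⟩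
    | push x =>
      obtain rfl : a = [] := List.isEmpty_iff.1 hal
      exact Or.inr ⟨rfl, Or.inl ⟨x, rfl⟩⟩

/-- The run from the initial configuration. -/
def run (f : Trans Q Γ) (q₀ : Q) (t : ℕ) : Q × Stack Γ := (step f)^[t] (q₀, ⟨[], []⟩)

/-- The height of the stack at time `t`. -/
def height (f : Trans Q Γ) (q₀ : Q) (t : ℕ) : ℕ := (word (run f q₀ t).2).length

theorem run_succ (f : Trans Q Γ) (q₀ : Q) (t : ℕ) : run f q₀ (t + 1) = step f (run f q₀ t) :=
  Function.iterate_succ_apply' _ _ _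

theorem run_add (f : Trans Q Γ) (q₀ : Q) (t n : ℕ) :
    run f q₀ (t + n) = (step f)^[n] (run f q₀ t) := by
  rw [run, run, ← Function.iterate_add_apply, Nat.add_comm]

theorem height_le {f : Trans Q Γ} (hf : Legal f) (q₀ : Q) (t : ℕ) : height f q₀ t ≤ t := by
  induction t with
  | zero => exact le_rfl
  | succ t ih =>
    unfold height at *
    rw [run_succ]
    rcases word_step hf (run f q₀ t) with h | ⟨-, ⟨x, h⟩ | ⟨x, h⟩⟩
    · rw [h]; omega
    · rw [h, List.length_cons]; omega
    · have := congrArg List.length h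
      rw [List.length_cons] at this; omega

theorem exists_forall_lt_height [Finite Q] [Finite Γ] {f : Trans Q Γ} {q₀ : Q}
    (hinj : Function.Injective (run f q₀)) (h : ℕ) : ∃ t₀, ∀ t ≥ t₀, h < height f q₀ t := by
  have hl : {l : List Γ | l.length ≤ h}.Finite := List.finite_length_le Γ h
  have hfin : {c : Q × Stack Γ | (word c.2).length ≤ h}.Finite := by
    refine Set.Finite.subset (((Set.finite_univ (α := Q)).prod (hl.prod hl)).image
      fun p => (p.1, (⟨p.2.1, p.2.2⟩ : Stack Γ))) ?_
    rintro ⟨q, b, a⟩ hc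
    simp only [word, List.length_append, List.length_reverse, Set.mem_ofPred_eq] at hc
    exact ⟨(q, b, a), ⟨trivial, show b.length ≤ h by omega, show a.length ≤ h by omega⟩, rfl⟩
  obtain ⟨N, hN⟩ := (hfin.preimage hinj.injOn).bddAbove
  refine ⟨N + 1, fun t ht => ?_⟩
  by_contra hc
  have : t ≤ N := hN (show (word (run f q₀ t).2).length ≤ h from not_lt.1 hc)
  omega

/-- The moment just after the last one of height at most `h`. The step in between raises the height,
so it is a push of `x` on a stack of height exactly `h`, and this lower part can never be altered
again. -/
theorem exists_last_time [Finite Q] [Finite Γ] {f : Trans Q Γ} (hf : Legal f) {q₀ : Q}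
    (hinj : Function.Injective (run f q₀)) (h : ℕ) : ∃ t q x w, w.length = h ∧
      run f q₀ t = (q, ⟨x :: w, []⟩) ∧
      ∀ t' ≥ t, ∃ B, B ≠ [] ∧ word (run f q₀ t').2 = B ++ w := by
  classical
  have hex := exists_forall_lt_height hinj h
  obtain ⟨s, hs⟩ : ∃ s, Nat.find hex = s + 1 := by
    refine Nat.exists_eq_succ_of_ne_zero fun h0 => ?_
    have := Nat.find_spec hex 0 (by omega)
    exact absurd this (by simp [height, run, word])
  have h₁ := Nat.find_spec hex
  rw [hs] at h₁
  have h₂ : height f q₀ s ≤ h := by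
    have := Nat.find_min hex (m := s) (by omega)
    push Not at this
    obtain ⟨t, ht, hth⟩ := this
    rcases Nat.lt_or_eq_of_le ht with ht | rfl
    · have := h₁ t ht; omega
    · exact hth
  have h₃ := h₁ (s + 1) le_rfl
  have hw := word_step hf (run f q₀ s)
  rw [← run_succ] at hw
  unfold height at h₁ h₂ h₃
  obtain ⟨ha, x, hx⟩ : (run f q₀ (s + 1)).2.above = [] ∧
      ∃ x, word (run f q₀ (s + 1)).2 = x :: word (run f q₀ s).2 := by
    rcases hw with hw | ⟨ha, hw | ⟨x, hw⟩⟩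
    · rw [hw] at h₃; omega
    · exact ⟨ha, hw⟩
    · have := congrArg List.length hw
      rw [List.length_cons] at this; omega
  have hlen : (word (run f q₀ s).2).length = h := by
    rw [hx, List.length_cons] at h₃; omega
  refine ⟨s + 1, (run f q₀ (s + 1)).1, x, word (run f q₀ s).2, hlen, ?_, ?_⟩
  · rw [← hx]
    generalize run f q₀ (s + 1) = c at *
    obtain ⟨q, b, a⟩ := c
    dsimp only at ha
    subst ha
    rfl
  · intro t' ht'
    induction t', ht' using Nat.le_induction with
    | base => exact ⟨[x], by simp, hx⟩
    | succ t ht ih =>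
      obtain ⟨B, hB, hBw⟩ := ih
      have h₄ := h₁ (t + 1) (by omega)
      rw [run_succ] at h₄ ⊢
      rcases word_step hf (run f q₀ t) with hw | ⟨-, ⟨y, hw⟩ | ⟨y, hw⟩⟩
      · exact ⟨B, hB, hw.trans hBw⟩
      · exact ⟨y :: B, by simp, by rw [hw, hBw]; rfl⟩
      · obtain ⟨y', B, rfl⟩ := List.exists_cons_of_ne_nil hB
        rw [hw, List.cons_append, List.cons.injEq] at hBw
        refine ⟨B, ?_, hBw.2⟩
        rintro rfl
        rw [hBw.2, List.nil_append, hlen] at h₄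
        omega

/-- Two moments of a run, such that the stack never becomes lower afterwards and the machine is in
the same state and sees the same symbol on the top of lower parts `w` and `z ++ w` that behave in
the same way. -/
structure Loop (f g : Trans Q Γ) (F : Set Q) (q₀ : Q) where
  t₀ : ℕ
  t₁ : ℕ
  q : Q
  x : Γ
  w : List Γ
  z : List Γ
  lt : t₀ < t₁
  run₀ : run f q₀ t₀ = (q, ⟨x :: w, []⟩)
  run₁ : run f q₀ t₁ = (q, ⟨x :: (z ++ w), []⟩)
  word₀ : ∀ t ≥ t₀, ∃ B, B ≠ [] ∧ word (run f q₀ t).2 = B ++ w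
  word₁ : ∀ t ≥ t₁, ∃ B, B ≠ [] ∧ word (run f q₀ t).2 = B ++ (z ++ w)
  lowerType_eq : lowerType f g F w = lowerType f g F (z ++ w)
  top : ∀ N, ∃ t ≥ N, (run f q₀ t).2.above = []

/-- Pigeonhole over the last times of all heights: there are only finitely many triples of state,
top symbol and `lowerType`. The earlier lower part persists, so it is a suffix of the later one. -/
theorem nonempty_loop [Finite Q] [Finite Γ] {f : Trans Q Γ} (hf : Legal f) (g : Trans Q Γ)
    (F : Set Q) {q₀ : Q} (hinj : Function.Injective (run f q₀)) : Nonempty (Loop f g F q₀) := by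
  choose t q x w hlen hrun hword using exists_last_time hf hinj
  have hlt : StrictMono t := by
    intro i j hij
    by_contra hc
    obtain ⟨B, hB, hw⟩ := hword j (t i) (not_lt.1 hc)
    rw [hrun] at hw
    have := congrArg List.length hw
    have h₁ := List.length_pos_of_ne_nil hB
    simp only [word, List.length_append, List.reverse_nil, List.length_nil, List.length_cons,
      hlen] at this
    omega
  obtain ⟨i, j, hne, he⟩ := Finite.exists_ne_map_eq_of_infinite
    fun i => (q i, x i, lowerType f g F (w i))
  wlog hij : i < j generalizing i j
  · exact this j i hne.symm he.symm (by omega)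
  simp only [Prod.mk.injEq] at he
  obtain ⟨hq, hx, hty⟩ := he
  obtain ⟨B, hB, hw⟩ := hword i (t j) (hlt hij).le
  obtain ⟨y, z, rfl⟩ := List.exists_cons_of_ne_nil hB
  rw [hrun] at hw
  simp only [word, List.reverse_nil, List.nil_append, List.cons_append, List.cons.injEq] at hw
  refine ⟨⟨t i, t j, q i, x i, w i, z, hlt hij, hrun i, ?_, hword i, ?_, ?_, fun N => ?_⟩⟩
  · rw [hrun, hq, hx, hw.2]
  · rw [← hw.2]; exact hword j
  · rw [← hw.2]; exact hty
  · exact ⟨t N, hlt.id_le N, by rw [hrun]⟩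

end StackRun

end TreeStorage

/-! ### The periodic structure of a non-repeating run -/

namespace TreeStorage

namespace StackRun

variable {Q Γ : Type}

/-- Two configurations that differ only in the lower part of the stack, `w` or `w'`, and have
their pointer above it. -/
def Shift (w w' : List Γ) (c c' : Q × Stack Γ) : Prop :=
  ∃ q b a, b ≠ [] ∧ c = (q, ⟨b ++ w, a⟩) ∧ c' = (q, ⟨b ++ w', a⟩)

theorem next_low_exit {f : Trans Q Γ} (hf : Legal f) {q₀ q : Q} {u u₂ : ℕ} {w t : List Γ} {x : Γ}
    (hu : run f q₀ u = (q, ⟨w, x :: t⟩)) (hlt : u ≤ u₂)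
    (hvis : w.length < (run f q₀ u₂).2.below.length)
    (hmin : ∀ m, u ≤ m → m < u₂ → (run f q₀ m).2.below.length ≤ w.length) :
    ∃ n r, LowExit f q w [] n r ∧ run f q₀ u₂ = (r, ⟨x :: w, t⟩) := by
  obtain ⟨n, rfl⟩ := Nat.exists_eq_add_of_le hlt
  rcases low_dichotomy hf q w [] n with H | ⟨k, hk, h0, r, H⟩
  · obtain ⟨q', b', a', hw, h'⟩ := H n le_rfl
    have := h' (x :: t) (by simp)
    rw [List.nil_append, ← hu, ← run_add] at this
    rw [this] at hvis
    have := congrArg List.length hw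
    simp at this hvis
    omega
  · have e := H.2 x t
    rw [List.nil_append, ← hu, ← run_add, List.reverse_nil, List.nil_append] at e
    rcases Nat.lt_or_eq_of_le hk with hk | rfl
    · have := hmin (u + k) (by omega) (by omega)
      rw [e, List.length_cons] at this
      omega
    · exact ⟨k, r, H, e⟩

theorem lowExit_unique {f : Trans Q Γ} {q r r' : Q} [Nonempty Γ] {w : List Γ} {n n' : ℕ}
    (h : LowExit f q w [] n r) (h' : LowExit f q w [] n' r') : r = r' := by
  obtain ⟨x⟩ := ‹Nonempty Γ›
  have key : ∀ {n n' r r'}, LowExit f q w [] n r → LowExit f q w [] n' r' → n' ≤ n := by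
    intro n n' r r' h h'
    by_contra hlt
    obtain ⟨q', b', a', hw, hq⟩ := h'.1 n (not_le.1 hlt)
    have e := hq [x] (by simp)
    rw [h.2 x []] at e
    simp only [Prod.mk.injEq, Stack.mk.injEq] at e
    have h₁ := congrArg List.length hw
    have h₂ := congrArg List.length e.2.1
    simp at h₁ h₂
    omega
  obtain rfl : n = n' := le_antisymm (key h' h) (key h h')
  have := (h.2 x []).symm.trans (h'.2 x [])
  exact (Prod.mk.inj this).1

/-- Here `s₂` and `u₂` are the next moments with the pointer above the lower part. Either both come
one step later, or both runs dip into the lower part and leave it in the same state because the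
types agree. The condition `hw` excludes that the upper part has been popped completely. -/
theorem shift_next {f g : Trans Q Γ} (hf : Legal f) {F : Set Q} {q₀ : Q} {s s₂ u u₂ : ℕ}
    {w w' : List Γ} (hty : lowerType f g F w = lowerType f g F w')
    (h : Shift w w' (run f q₀ s) (run f q₀ u)) (hw : word (run f q₀ (s + 1)).2 ≠ w)
    (hs : s < s₂) (hsv : w.length < (run f q₀ s₂).2.below.length)
    (hsm : ∀ m, s < m → m < s₂ → (run f q₀ m).2.below.length ≤ w.length)
    (hu : u < u₂) (huv : w'.length < (run f q₀ u₂).2.below.length)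
    (hum : ∀ m, u < m → m < u₂ → (run f q₀ m).2.below.length ≤ w'.length) :
    Shift w w' (run f q₀ s₂) (run f q₀ u₂) := by
  obtain ⟨q, b, a, hb, hcs, hcu⟩ := h
  obtain ⟨q', b', a', h', -⟩ := step_visible hf q hb a
  have hcs' : run f q₀ (s + 1) = (q', ⟨b' ++ w, a'⟩) := by rw [run_succ, hcs, h']
  have hcu' : run f q₀ (u + 1) = (q', ⟨b' ++ w', a'⟩) := by rw [run_succ, hcu, h']
  rcases eq_or_ne b' [] with rfl | hb'
  · rw [List.nil_append] at hcs' hcu'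
    cases a' with
    | nil => rw [hcs'] at hw; exact absurd rfl hw
    | cons x t =>
      obtain ⟨n, r, hE, e⟩ := next_low_exit hf hcs' hs hsv hsm
      obtain ⟨n', r', hE', e'⟩ := next_low_exit hf hcu' hu huv hum
      obtain ⟨n₂, hE₂⟩ := exists_lowExit_of_lowerType hty hE
      have : Nonempty Γ := ⟨x⟩
      obtain rfl := lowExit_unique hE' hE₂
      exact ⟨r', [x], t, by simp, e, e'⟩
  · have hpos := List.length_pos_of_ne_nil hb'
    have es : s₂ = s + 1 := by
      by_contra hne
      have := hsm (s + 1) (by omega) (by omega)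
      rw [hcs', List.length_append] at this
      omega
    have eu : u₂ = u + 1 := by
      by_contra hne
      have := hum (u + 1) (by omega) (by omega)
      rw [hcu', List.length_append] at this
      omega
    rw [es, eu]
    exact ⟨q', b', a', hb', hcs', hcu'⟩

/-- The `k`-fold repetition of a word. -/
def pow (z : List Γ) (k : ℕ) : List Γ := (List.replicate k z).flatten

theorem pow_succ_eq (z : List Γ) (k : ℕ) : pow z (k + 1) = pow z k ++ z := by
  rw [pow, List.replicate_succ', List.flatten_append]
  simp [pow]

theorem pow_add_eq (z : List Γ) (j k : ℕ) : pow z (j + k) = pow z j ++ pow z k := by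
  rw [pow, List.replicate_add, List.flatten_append]
  rfl

theorem length_pow_eq (z : List Γ) (k : ℕ) : (pow z k).length = k * z.length := by
  simp [pow]

namespace Loop

variable {f g : Trans Q Γ} {F : Set Q} {q₀ : Q} (L : Loop f g F q₀)

/-- From `t₀` on, the pointer is above the lower part `w`. -/
def V₀ (t : ℕ) : Prop := L.t₀ ≤ t ∧ L.w.length < (run f q₀ t).2.below.length

/-- From `t₁` on, the pointer is above the lower part `z ++ w`. -/
def V₁ (t : ℕ) : Prop := L.t₁ ≤ t ∧ (L.z ++ L.w).length < (run f q₀ t).2.below.length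

theorem V₁.V₀ {L : Loop f g F q₀} {t : ℕ} (h : L.V₁ t) : L.V₀ t := by
  have := h.2
  rw [List.length_append] at this
  exact ⟨L.lt.le.trans h.1, by omega⟩

theorem V₁_of_top {t : ℕ} (ht : L.t₁ ≤ t) (htop : (run f q₀ t).2.above = []) : L.V₁ t := by
  obtain ⟨B, hB, hw⟩ := L.word₁ t ht
  rw [word, htop, List.reverse_nil, List.nil_append] at hw
  refine ⟨ht, ?_⟩
  rw [hw, List.length_append (as := B)]
  have := List.length_pos_of_ne_nil hB
  omega

theorem infinite_V₁ : {t | L.V₁ t}.Infinite := by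
  refine Set.infinite_of_forall_exists_gt fun N => ?_
  obtain ⟨t, ht, htop⟩ := L.top (max (N + 1) L.t₁)
  exact ⟨t, L.V₁_of_top (by omega) htop, by omega⟩

theorem infinite_V₀ : {t | L.V₀ t}.Infinite := L.infinite_V₁.mono fun _ h => h.V₀

theorem V₀_t₀ : L.V₀ L.t₀ := ⟨le_rfl, by rw [L.run₀]; simp⟩

theorem V₁_t₁ : L.V₁ L.t₁ := ⟨le_rfl, by rw [L.run₁]; simp⟩

theorem nth_zero_of_le {p : ℕ → Prop} {t : ℕ} (h : p t) (hle : ∀ s, p s → t ≤ s) :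
    Nat.nth p 0 = t := by
  rw [Nat.nth_zero]
  exact IsLeast.csInf_eq ⟨h, hle⟩

/-- Counting only the moments with the pointer above the lower part synchronises the two runs, whose
visits below may last differently long. -/
theorem shift_nth (hf : Legal f) (i : ℕ) :
    Shift L.w (L.z ++ L.w) (run f q₀ (Nat.nth L.V₀ i)) (run f q₀ (Nat.nth L.V₁ i)) := by
  classical
  have hbetween : ∀ {p : ℕ → Prop}, {t | p t}.Infinite → ∀ i m, Nat.nth p i < m →
      m < Nat.nth p (i + 1) → ¬ p m := by
    intro p hp i m h₁ h₂ hm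
    rw [← Nat.nth_count hm] at h₁ h₂
    have h₁ := (Nat.nth_strictMono hp).lt_iff_lt.1 h₁
    have h₂ := (Nat.nth_strictMono hp).lt_iff_lt.1 h₂
    omega
  induction i with
  | zero =>
    rw [nth_zero_of_le L.V₀_t₀ fun s hs => hs.1, nth_zero_of_le L.V₁_t₁ fun s hs => hs.1]
    exact ⟨L.q, [L.x], [], by simp, L.run₀, L.run₁⟩
  | succ i ih =>
    have h₀ := Nat.nth_mem_of_infinite L.infinite_V₀ i
    have h₁ := Nat.nth_mem_of_infinite L.infinite_V₁ i
    refine shift_next hf L.lowerType_eq ih ?_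
      (Nat.nth_strictMono L.infinite_V₀ (Nat.lt_succ_self i))
      (Nat.nth_mem_of_infinite L.infinite_V₀ (i + 1)).2 (fun m h₂ h₃ => ?_)
      (Nat.nth_strictMono L.infinite_V₁ (Nat.lt_succ_self i))
      (Nat.nth_mem_of_infinite L.infinite_V₁ (i + 1)).2 (fun m h₂ h₃ => ?_)
    · obtain ⟨B, hB, hw⟩ := L.word₀ (Nat.nth L.V₀ i + 1) (h₀.1.trans (Nat.le_succ _))
      rw [hw]
      simpa using hB
    · by_contra hc
      exact hbetween L.infinite_V₀ i m h₂ h₃ ⟨h₀.1.trans h₂.le, not_le.1 hc⟩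
    · by_contra hc
      exact hbetween L.infinite_V₁ i m h₂ h₃ ⟨h₁.1.trans h₂.le, not_le.1 hc⟩

open Classical in
/-- The moment of the run from `t₁` on that corresponds to a moment of the run from `t₀` on. -/
noncomputable def next (t : ℕ) : ℕ := Nat.nth L.V₁ (Nat.count L.V₀ t)

theorem V₁_next (t : ℕ) : L.V₁ (L.next t) := Nat.nth_mem_of_infinite L.infinite_V₁ _

theorem shift_run_next (hf : Legal f) {t : ℕ} (ht : L.V₀ t) :
    Shift L.w (L.z ++ L.w) (run f q₀ t) (run f q₀ (L.next t)) := by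
  classical
  have := L.shift_nth hf (Nat.count L.V₀ t)
  rwa [Nat.nth_count ht] at this

theorem next_mono : Monotone L.next := by
  classical
  exact (Nat.nth_monotone L.infinite_V₁).comp (Nat.count_monotone _)

theorem next_lt {s t : ℕ} (hs : L.V₀ s) (hst : s < t) : L.next s < L.next t := by
  classical
  exact Nat.nth_strictMono L.infinite_V₁ (Nat.count_strict_mono hs hst)

theorem exists_next_eq {u : ℕ} (hu : L.V₁ u) : ∃ s, L.V₀ s ∧ L.next s = u := by
  classical
  refine ⟨Nat.nth L.V₀ (Nat.count L.V₁ u), Nat.nth_mem_of_infinite L.infinite_V₀ _, ?_⟩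
  rw [next, Nat.count_nth_of_infinite L.infinite_V₀, Nat.nth_count hu]

/-- The beginning of the `k`-th period. -/
noncomputable def T (k : ℕ) : ℕ := L.next^[k] L.t₀

theorem T_succ (k : ℕ) : L.T (k + 1) = L.next (L.T k) := Function.iterate_succ_apply' _ _ _

theorem T_zero : L.T 0 = L.t₀ := rfl

/-- The first moment above `z ++ w` is `t₁`, and it corresponds to the first moment above `w`. -/
theorem T_one : L.T 1 = L.t₁ := by
  classical
  obtain ⟨s, hs, h⟩ := L.exists_next_eq L.V₁_t₁
  rw [T_succ, T_zero]
  refine le_antisymm ?_ (L.V₁_next _).1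
  rw [← h]
  exact L.next_mono hs.1

theorem V₀_T (k : ℕ) : L.V₀ (L.T k) := by
  cases k with
  | zero => exact L.V₀_t₀
  | succ k => rw [T_succ]; exact (L.V₁_next _).V₀

theorem T_strictMono : StrictMono L.T := by
  refine strictMono_nat_of_lt_succ fun k => ?_
  induction k with
  | zero => rw [L.T_one]; exact L.lt
  | succ k ih =>
    rw [L.T_succ, L.T_succ (k + 1)]
    exact L.next_lt (L.V₀_T k) ih

theorem t₀_le_T (k : ℕ) : L.t₀ ≤ L.T k := L.T_strictMono.monotone (Nat.zero_le k)

theorem exists_block {t : ℕ} (ht : L.t₀ ≤ t) : ∃ k, L.T k ≤ t ∧ t < L.T (k + 1) := by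
  have hex : ∃ k, t < L.T k := ⟨t + 1, (L.T_strictMono.id_le (t + 1))⟩
  classical
  obtain ⟨k, hk⟩ : ∃ k, Nat.find hex = k + 1 := by
    refine Nat.exists_eq_succ_of_ne_zero fun h0 => ?_
    have := Nat.find_spec hex
    rw [h0, T_zero] at this
    omega
  refine ⟨k, not_lt.1 (Nat.find_min hex (by omega)), ?_⟩
  rw [← hk]
  exact Nat.find_spec hex

theorem next_mem_block {k s : ℕ} (hs : L.V₀ s) (h₁ : L.T k ≤ s) (h₂ : s < L.T (k + 1)) :
    L.T (k + 1) ≤ L.next s ∧ L.next s < L.T (k + 2) := by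
  rw [L.T_succ, L.T_succ (k + 1)]
  exact ⟨L.next_mono h₁, L.next_lt hs h₂⟩

theorem V₀_iterate {s : ℕ} (hs : L.V₀ s) (m : ℕ) : L.V₀ (L.next^[m] s) := by
  cases m with
  | zero => exact hs
  | succ m => rw [Function.iterate_succ_apply']; exact (L.V₁_next _).V₀

theorem iterate_mem_block {k s : ℕ} (hs : L.V₀ s) (h₁ : L.T k ≤ s) (h₂ : s < L.T (k + 1))
    (m : ℕ) : L.T (k + m) ≤ L.next^[m] s ∧ L.next^[m] s < L.T (k + m + 1) := by
  induction m with
  | zero => exact ⟨h₁, h₂⟩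
  | succ m ih =>
    rw [Function.iterate_succ_apply']
    exact L.next_mem_block (L.V₀_iterate hs m) ih.1 ih.2

/-- Passing to the corresponding moment replaces `w` by `z ++ w`; the result again lies above `w`,
so this can be repeated. -/
theorem run_iterate (hf : Legal f) {s : ℕ} (hs : L.V₀ s) {q : Q} {b a : List Γ}
    (h : run f q₀ s = (q, ⟨b ++ L.w, a⟩)) (k : ℕ) :
    run f q₀ (L.next^[k] s) = (q, ⟨b ++ pow L.z k ++ L.w, a⟩) := by
  induction k with
  | zero => simpa [pow] using h
  | succ k ih =>
    rw [Function.iterate_succ_apply']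
    obtain ⟨q', b', a', -, e, e'⟩ := L.shift_run_next hf (L.V₀_iterate hs k)
    rw [ih] at e
    simp only [Prod.mk.injEq, Stack.mk.injEq, List.append_cancel_right_eq] at e
    obtain ⟨rfl, rfl, rfl⟩ := e
    rw [e', pow_succ_eq]
    simp

/-- Every moment of the `k`-th period with the pointer at the top comes from the first period. -/
theorem exists_of_top (hf : Legal f) {k : ℕ} : ∀ {u : ℕ}, L.T k ≤ u → u < L.T (k + 1) →
    (run f q₀ u).2.above = [] → ∃ s, L.V₀ s ∧ s < L.t₁ ∧ L.next^[k] s = u := by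
  induction k with
  | zero =>
    intro u h₁ h₂ htop
    refine ⟨u, ⟨h₁, ?_⟩, by rwa [← L.T_one], rfl⟩
    obtain ⟨B, hB, hw⟩ := L.word₀ u h₁
    rw [word, htop, List.reverse_nil, List.nil_append] at hw
    rw [hw, List.length_append]
    have := List.length_pos_of_ne_nil hB
    omega
  | succ k ih =>
    intro u h₁ h₂ htop
    have hV := L.V₁_of_top (t := u) (by
      rw [← L.T_one]; exact (L.T_strictMono.monotone (by omega)).trans h₁) htop
    obtain ⟨u', hu', rfl⟩ := L.exists_next_eq hV
    rw [L.T_succ] at h₁ h₂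
    obtain ⟨q', b', a', -, e, e'⟩ := L.shift_run_next hf hu'
    obtain ⟨s, hs, hlt, rfl⟩ := ih (u := u')
      (by by_contra hc; exact absurd (L.next_lt hu' (not_le.1 hc)) (by omega))
      (by by_contra hc; exact absurd (L.next_mono (not_lt.1 hc)) (by omega))
      (by rw [e]; rw [e'] at htop; exact htop)
    exact ⟨s, hs, hlt, Function.iterate_succ_apply' _ _ _⟩

theorem V₀_form (hf : Legal f) {s : ℕ} (hs : L.V₀ s) : ∃ q b a, b ≠ [] ∧
    run f q₀ s = (q, ⟨b ++ L.w, a⟩) := by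
  obtain ⟨q, b, a, hb, e, -⟩ := L.shift_run_next hf hs
  exact ⟨q, b, a, hb, e⟩

theorem top_T (hf : Legal f) (k : ℕ) : (run f q₀ (L.T k)).2.above = [] := by
  have := L.run_iterate hf L.V₀_t₀ (b := [L.x]) L.run₀ k
  rw [T, this]

/-- The contents change only in steps that end at the top, so the last moment at the top already has
the present contents. -/
theorem exists_last_top (hf : Legal f) {k t : ℕ} (ht : L.T k ≤ t) : ∃ u, L.T k ≤ u ∧ u ≤ t ∧
    (run f q₀ u).2.above = [] ∧ word (run f q₀ u).2 = word (run f q₀ t).2 ∧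
    ∀ m, u < m → m ≤ t → (run f q₀ m).2.above ≠ [] := by
  induction t, ht using Nat.le_induction with
  | base => exact ⟨L.T k, le_rfl, le_rfl, L.top_T hf k, rfl, fun m h₁ h₂ => by omega⟩
  | succ t ht ih =>
    by_cases htop : (run f q₀ (t + 1)).2.above = []
    · exact ⟨t + 1, by omega, le_rfl, htop, rfl, fun m h₁ h₂ => by omega⟩
    · obtain ⟨u, h₁, h₂, h₃, h₄, h₅⟩ := ih
      refine ⟨u, h₁, by omega, h₃, ?_, fun m h₆ h₇ => ?_⟩
      · rcases word_step hf (run f q₀ t) with h | ⟨h, -⟩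
        · rw [h₄, run_succ, h]
        · rw [← run_succ] at h
          exact absurd h htop
      · rcases Nat.lt_or_eq_of_le h₇ with h₇ | rfl
        · exact h₅ m h₆ (by omega)
        · exact htop

/-- The stacks of the `k`-th period arise from those of the first one by inserting `z` `k` times. -/
theorem block_form (hf : Legal f) {k t : ℕ} (h₁ : L.T k ≤ t) (h₂ : t < L.T (k + 1)) :
    ∃ s q b n, L.V₀ s ∧ s < L.t₁ ∧ b ≠ [] ∧ run f q₀ s = (q, ⟨b ++ L.w, []⟩) ∧
      word (run f q₀ t).2 = b ++ pow L.z k ++ L.w ∧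
      (run f q₀ (L.next^[k] s)) = (q, ⟨b ++ pow L.z k ++ L.w, []⟩) ∧
      L.next^[k] s + n = t ∧ ∀ m, 0 < m → m ≤ n → (run f q₀ (L.next^[k] s + m)).2.above ≠ [] := by
  obtain ⟨u, h₃, h₄, h₅, h₆, h₇⟩ := L.exists_last_top hf h₁
  obtain ⟨s, hs, hlt, rfl⟩ := L.exists_of_top hf h₃ (by omega) h₅
  obtain ⟨q, b, a, hb, e⟩ := L.V₀_form hf hs
  have e' := L.run_iterate hf hs e k
  rw [e'] at h₅
  dsimp only at h₅
  subst h₅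
  refine ⟨s, q, b, t - L.next^[k] s, hs, hlt, hb, e, ?_, e', by omega, fun m h₈ h₉ =>
    h₇ _ (by omega) (by omega)⟩
  rw [← h₆, e']
  rfl

/-- No configuration recurs, so it is enough to count those of the first `K` periods: `K` periods
with boundedly many contents each, and `O(K)` pointer positions. -/
theorem T_le [Finite Q] (hf : Legal f) (hinj : Function.Injective (run f q₀)) :
    ∃ C, ∀ K, L.T K ≤ C * (K + 1) ^ 2 := by
  classical
  have := Fintype.ofFinite Q
  refine ⟨L.t₀ + Fintype.card Q * L.t₁ * (L.t₁ + L.z.length + 1), fun K => ?_⟩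
  -- The code of a moment: its state, its period, the moment of the first period that yields its
  -- contents, and its pointer height. The contents in period `k` have length at most `t₁ + k *
  -- z.length`.
  have hcard : (Finset.Ico L.t₀ (L.T K)).card ≤ (Finset.univ : Finset
      (Q × Fin K × Fin L.t₁ × Fin (L.t₁ + K * L.z.length + 1))).card := by
    refine Finset.card_le_card_of_forall_subsingleton
      (fun t p => (run f q₀ t).1 = p.1 ∧ (run f q₀ t).2.below.length = p.2.2.2 ∧
        word (run f q₀ t).2 = word (run f q₀ (L.next^[p.2.1] p.2.2.1)).2) ?_ ?_
    · intro t ht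
      rw [Finset.mem_Ico] at ht
      obtain ⟨k, hk₁, hk₂⟩ := L.exists_block ht.1
      have hkK : k < K := L.T_strictMono.lt_iff_lt.1 (hk₁.trans_lt ht.2)
      obtain ⟨s, q, b, n, hs, hlt, hb, e, hw, e', -, -⟩ := L.block_form hf hk₁ hk₂
      have hl := height_le hf q₀ s
      rw [height, e] at hl
      have hlen := congrArg List.length hw
      simp only [word, List.length_append, List.length_reverse, List.length_nil,
        length_pow_eq] at hl hlen
      have hmul : k * L.z.length ≤ K * L.z.length := Nat.mul_le_mul_right _ hkK.le
      refine ⟨((run f q₀ t).1, ⟨k, hkK⟩, ⟨s, hlt⟩, ⟨(run f q₀ t).2.below.length, by omega⟩),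
        Finset.mem_univ _, rfl, rfl, ?_⟩
      dsimp only
      rw [hw, e']
      rfl
    · rintro p - t ⟨-, h₁, h₂, h₃⟩ t' ⟨-, h₁', h₂', h₃'⟩
      apply hinj
      have hq := h₁.trans h₁'.symm
      have hl := h₂.trans h₂'.symm
      have hw := h₃.trans h₃'.symm
      generalize run f q₀ t = c at *
      generalize run f q₀ t' = c' at *
      obtain ⟨q, b, a⟩ := c
      obtain ⟨q', b', a'⟩ := c'
      dsimp only [word] at hq hl hw
      obtain ⟨ha, hb⟩ := List.append_inj' hw hl
      rw [hq, hb, List.reverse_injective ha]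
  rw [Nat.card_Ico, Finset.card_univ] at hcard
  simp only [Fintype.card_prod, Fintype.card_fin] at hcard
  have h₁ : L.t₁ + K * L.z.length + 1 ≤ (L.t₁ + L.z.length + 1) * (K + 1) := by
    nlinarith [Nat.zero_le (K * L.t₁), Nat.zero_le K]
  have h₂ : Fintype.card Q * (K * (L.t₁ * (L.t₁ + K * L.z.length + 1))) ≤
      Fintype.card Q * ((K + 1) * (L.t₁ * ((L.t₁ + L.z.length + 1) * (K + 1)))) := by
    gcongr
    omega
  have h₃ : L.t₀ ≤ L.t₀ * (K + 1) ^ 2 := Nat.le_mul_of_pos_right _ (by positivity)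
  have h₄ : Fintype.card Q * ((K + 1) * (L.t₁ * ((L.t₁ + L.z.length + 1) * (K + 1)))) =
      Fintype.card Q * L.t₁ * (L.t₁ + L.z.length + 1) * (K + 1) ^ 2 := by ring
  rw [add_mul]
  omega

end Loop

end StackRun

end TreeStorage

/-! ### Accepting moments occur at least quadratically often -/

namespace TreeStorage

namespace StackRun

variable {Q Γ : Type}

namespace Loop

variable {f e g : Trans Q Γ} {F : Set Q} {q₀ : Q} (L : Loop f g F q₀)

/-- One moment is taken from each period of the progression; period `k₀ + m * R` ends by a time
quadratic in `m` by `T_le`. -/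
theorem exists_slow_of_periodic [Finite Q] (hf : Legal f)
    (hinj : Function.Injective (run f q₀)) {p : ℕ → Prop} {k₀ R : ℕ} (hR : 0 < R)
    (h : ∀ m, ∃ t, p t ∧ L.T (k₀ + m * R) ≤ t ∧ t < L.T (k₀ + m * R + 1)) :
    ∃ C a, StrictMono a ∧ (∀ m, p (a m)) ∧ ∀ m, a m ≤ C * (m + 1) ^ 2 := by
  obtain ⟨C, hC⟩ := L.T_le hf hinj
  choose a ha h₁ h₂ using h
  refine ⟨C * (k₀ + R + 2) ^ 2, a, strictMono_nat_of_lt_succ fun m => ?_, ha, fun m => ?_⟩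
  · refine (h₂ m).trans_le (le_trans (L.T_strictMono.monotone ?_) (h₁ (m + 1)))
    rw [add_mul]
    omega
  · refine (h₂ m).le.trans ((hC _).trans ?_)
    rw [mul_assoc, ← mul_pow]
    gcongr
    nlinarith [Nat.zero_le (k₀ * m)]

/-- Some visit of the lower part `w`, from the top of the stack `b ++ pow z k ++ w`, reaches an
accepting configuration. -/
def Good (e : Trans Q Γ) (q : Q) (b : List Γ) (k : ℕ) : Prop :=
  ∃ n p d a, a.reverse ++ d = L.w ∧
    Inside f n (step f (q, ⟨b ++ pow L.z k ++ L.w, []⟩)) (p, ⟨d, a ++ (b ++ pow L.z k).reverse⟩) ∧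
    EndAccepts e g F (p, ⟨d, a ++ (b ++ pow L.z k).reverse⟩)

/-- Each further `z` is inserted by exchanging `w` for `z ++ w`, which have the same type. -/
theorem acceptsFrom_pow (hg : Legal g) {b : List Γ} {k : ℕ} (R : ℕ) {r : Q}
    (h : AcceptsFrom g F (r, ⟨b ++ pow L.z k ++ L.w, []⟩)) :
    AcceptsFrom g F (r, ⟨b ++ pow L.z (k + R) ++ L.w, []⟩) := by
  induction R with
  | zero => exact h
  | succ R ih =>
    obtain ⟨n, hn⟩ := ih
    have := acceptsFrom_lower hg L.lowerType_eq n _ _ _ hn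
    have e₁ : b ++ pow L.z (k + (R + 1)) ++ L.w = b ++ pow L.z (k + R) ++ (L.z ++ L.w) := by
      rw [← Nat.add_assoc, pow_succ_eq]
      simp only [List.append_assoc]
    rwa [e₁]

/-- With `k = i + j`, the upper part `b ++ pow z i` is exchanged for `b ++ pow z (i + R)` above the
unchanged `pow z j ++ w`. The descent avoids the top; if the computation after the endmarker climbs
back to it, `acceptsFrom_pow` applies. -/
theorem good_add (hf : Legal f) (he : Legal e) (hg : Legal g) {q : Q} {b : List Γ} (hb : b ≠ [])
    {i R k : ℕ} (hik : i ≤ k) (hU : upperType f g F (b ++ pow L.z i).reverse =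
      upperType f g F (b ++ pow L.z (i + R)).reverse) (h : L.Good e q b k) :
    L.Good e q b (k + R) := by
  obtain ⟨n, p, d, a, hw, hin, hacc⟩ := h
  obtain ⟨j, rfl⟩ := Nat.exists_eq_add_of_le hik
  have e₁ : b ++ pow L.z (i + j) = (b ++ pow L.z i) ++ pow L.z j := by
    rw [pow_add_eq, List.append_assoc]
  have e₂ : b ++ pow L.z (i + j + R) = (b ++ pow L.z (i + R)) ++ pow L.z j := by
    rw [show i + j + R = (i + R) + j by omega, pow_add_eq, List.append_assoc]
  have hy : (b ++ pow L.z i).reverse ≠ [] := by simp [hb]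
  have hy' : (b ++ pow L.z (i + R)).reverse ≠ [] := by simp [hb]
  have hT : ∀ r, AcceptsFrom g F
        (r, ⟨(b ++ pow L.z i).reverse.reverse ++ (pow L.z j ++ L.w), []⟩) →
      AcceptsFrom g F
        (r, ⟨(b ++ pow L.z (i + R)).reverse.reverse ++ (pow L.z j ++ L.w), []⟩) := by
    intro r hr
    rw [List.reverse_reverse, ← List.append_assoc, ← e₁] at hr
    rw [List.reverse_reverse, ← List.append_assoc, ← e₂]
    exact L.acceptsFrom_pow hg R hr
  have hv : (a ++ (pow L.z j).reverse).reverse ++ d = pow L.z j ++ L.w := by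
    rw [← hw]; simp
  rw [e₁, List.reverse_append, ← List.append_assoc a] at hin hacc
  obtain ⟨n', hin'⟩ := inside_upper_of_top (n := n) (q := q) hf hy hy' hU hv (by
    rwa [List.reverse_reverse, ← List.append_assoc])
  have hacc' := endAccepts_upper he hg hy hy' hU hT hv hacc
  rw [List.reverse_reverse, ← List.append_assoc, ← e₂] at hin'
  have e₃ : (a ++ (pow L.z j).reverse) ++ (b ++ pow L.z (i + R)).reverse =
      a ++ (b ++ pow L.z (i + j + R)).reverse := by
    rw [e₂, List.reverse_append (as := b ++ pow L.z (i + R)), List.append_assoc]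
  rw [e₃] at hin' hacc'
  exact ⟨n', p, d, a, hw, hin', hacc'⟩

theorem exists_of_good (hf : Legal f) {q : Q} {b : List Γ} {s k : ℕ} (hs : L.V₀ s)
    (hlt : s < L.t₁) (hrun : run f q₀ s = (q, ⟨b ++ L.w, []⟩)) (h : L.Good e q b k) :
    ∃ t, EndAccepts e g F (run f q₀ t) ∧ L.T k ≤ t ∧ t < L.T (k + 1) := by
  obtain ⟨n, p, d, a, -, hin, hacc⟩ := h
  have hblock := L.iterate_mem_block (k := 0) hs hs.1 (by rwa [L.T_one]) k
  rw [Nat.zero_add] at hblock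
  rw [← L.run_iterate hf hs hrun k, ← run_succ] at hin
  refine ⟨L.next^[k] s + 1 + n, ?_, by omega, ?_⟩
  · rw [run_add, hin.1]
    exact hacc
  · by_contra hc
    -- The next period starts with the pointer at the top, so a visit that avoids the top ends
    -- before it.
    refine hin.2 (L.T (k + 1) - (L.next^[k] s + 1)) (by omega) ?_
    rw [← run_add, Nat.add_sub_cancel' (by omega)]
    exact L.top_T hf _

/-- Since the last moment at the top, given by `block_form`, the contents have not changed and the
pointer has descended into `w`. -/
theorem good_of_endAccepts (hf : Legal f) {k t : ℕ} (h₁ : L.T k ≤ t)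
    (h₂ : t < L.T (k + 1)) (hacc : EndAccepts e g F (run f q₀ t)) (hV : ¬ L.V₀ t) :
    ∃ s q b, L.V₀ s ∧ s < L.t₁ ∧ b ≠ [] ∧ run f q₀ s = (q, ⟨b ++ L.w, []⟩) ∧ L.Good e q b k := by
  obtain ⟨s, q, b, n, hs, hlt, hb, hrun, hw, hrun', rfl, htop⟩ := L.block_form hf h₁ h₂
  refine ⟨s, q, b, hs, hlt, hb, hrun, ?_⟩
  have hlow : (run f q₀ (L.next^[k] s + n)).2.below.length ≤ L.w.length := by
    by_contra hc
    exact hV ⟨(L.t₀_le_T k).trans h₁, not_le.1 hc⟩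
  rcases Nat.eq_zero_or_pos n with rfl | hn
  · rw [Nat.add_zero, hrun'] at hlow
    have := List.length_pos_of_ne_nil hb
    simp only [List.length_append] at hlow
    omega
  rcases hc : run f q₀ (L.next^[k] s + n) with ⟨p, d, a'⟩
  rw [hc] at hacc hw hlow
  dsimp only [word] at hw hlow
  have hsuf : d <:+ L.w := List.suffix_of_suffix_length_le ⟨_, hw⟩ ⟨_, rfl⟩ hlow
  obtain ⟨a, ha⟩ := hsuf
  have ha' : a' = a.reverse ++ (b ++ pow L.z k).reverse := by
    rw [← ha, ← List.append_assoc, List.append_cancel_right_eq] at hw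
    simpa using congrArg List.reverse hw
  subst ha'
  refine ⟨n - 1, p, d, a.reverse, by simpa using ha, ⟨?_, fun m hm => ?_⟩, hacc⟩
  · rw [← hrun', ← run_succ, ← run_add, ← hc]
    congr 1
    omega
  · rw [← hrun', ← run_succ, ← run_add, Nat.add_assoc, Nat.add_comm 1 m]
    exact htop _ (by omega) (by omega)

/-- If the machine can accept infinitely often, then the `m`-th time is at most quadratic. -/
theorem exists_slow [Finite Q] (L : Loop f g F q₀) (hf : Legal f) (he : Legal e) (hg : Legal g)
    (hinj : Function.Injective (run f q₀))
    (hA : ∀ N, ∃ t ≥ N, EndAccepts e g F (run f q₀ t)) :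
    ∃ C a, StrictMono a ∧ (∀ m, EndAccepts e g F (run f q₀ (a m))) ∧
      ∀ m, a m ≤ C * (m + 1) ^ 2 := by
  by_cases hV : ∃ s, L.V₀ s ∧ EndAccepts e g F (run f q₀ s)
  · obtain ⟨s, hs, hacc⟩ := hV
    obtain ⟨k₀, h₁, h₂⟩ := L.exists_block hs.1
    refine L.exists_slow_of_periodic hf hinj
      (p := fun t => EndAccepts e g F (run f q₀ t)) (k₀ := k₀) (R := 1) one_pos fun m => ?_
    rw [Nat.mul_one]
    refine ⟨L.next^[m] s, ?_, L.iterate_mem_block hs h₁ h₂ m⟩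
    induction m with
    | zero => exact hacc
    | succ m ih =>
      rw [Function.iterate_succ_apply']
      obtain ⟨q, b, a, hb, h, h'⟩ := L.shift_run_next hf (L.V₀_iterate hs m)
      rw [h] at ih
      rw [h']
      exact endAccepts_lower he hg L.lowerType_eq hb ih
  · push Not at hV
    -- The pigeonhole treats all moments `s < t₁` at once, because the one that is needed is known
    -- only after `i` has been fixed. The prefix taken is `b` when the stack is `b ++ w` with the
    -- pointer at the top.
    obtain ⟨i, i', hne, hU⟩ := Finite.exists_ne_map_eq_of_infinite
      fun i (s : Fin L.t₁) => upperType f g F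
        ((run f q₀ s).2.below.take ((run f q₀ s).2.below.length - L.w.length) ++
          pow L.z i).reverse
    wlog hii : i < i' generalizing i i'
    · exact this i' i hne.symm hU.symm (by omega)
    obtain ⟨R, rfl⟩ := Nat.exists_eq_add_of_le hii.le
    -- Accepting after `T i` ensures that the stack holds at least `i` copies of `z`, as `good_add`
    -- requires.
    obtain ⟨t, ht, hacc⟩ := hA (L.T i)
    obtain ⟨k₀, h₁, h₂⟩ := L.exists_block ((L.t₀_le_T i).trans ht)
    have hik : i ≤ k₀ := by
      by_contra hc
      have := L.T_strictMono.monotone (show k₀ + 1 ≤ i by omega)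
      omega
    obtain ⟨s, q, b, hs, hlt, hb, hrun, hgood⟩ :=
      L.good_of_endAccepts hf h₁ h₂ hacc fun h => hV t h hacc
    have hU' := congrFun hU ⟨s, hlt⟩
    simp only [hrun, List.length_append, Nat.add_sub_cancel, List.take_left'] at hU'
    refine L.exists_slow_of_periodic hf hinj
      (p := fun t => EndAccepts e g F (run f q₀ t)) (k₀ := k₀) (R := R) (by omega) fun m => ?_
    refine L.exists_of_good hf hs hlt hrun ?_
    induction m with
    | zero => simpa using hgood
    | succ m ih =>
      rw [add_mul, one_mul, ← Nat.add_assoc]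
      exact L.good_add hf he hg hb (by omega) hU' ih

end Loop

end StackRun

/-! ### From stack automata to a single run on unbounded input -/

namespace DSA

open StackRun

variable (M : DSA Unit)

/-- The steps without input. -/
def silent : Trans M.Q M.Γ := fun q t x => M.δ q none t x

/-- The steps that read the letter. -/
def onLetter : Trans M.Q M.Γ := fun q t x => M.δ q (some (.letter ())) t x

/-- The steps that read the endmarker. -/
def onEnd : Trans M.Q M.Γ := fun q t x => M.δ q (some .endmarker) t x

/-- The steps on an unbounded input. -/
def free : Trans M.Q M.Γ := fun q t x => (M.silent q t x).or (M.onLetter q t x)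

theorem legal_silent : Legal M.silent := fun q t x => M.allowed q none t x

theorem legal_onEnd : Legal M.onEnd := fun q t x => M.allowed q (some .endmarker) t x

theorem legal_free : Legal M.free := by
  intro q t x q' op h
  rcases Option.or_eq_some_iff.1 h with h | ⟨-, h⟩
  · exact M.allowed _ _ _ _ _ _ h
  · exact M.allowed _ _ _ _ _ _ h

/-- The run on an unbounded input. -/
def freeRun (t : ℕ) : M.Q × Stack M.Γ := run M.free M.q₀ t

theorem freeRun_succ (t : ℕ) : M.freeRun (t + 1) = step M.free (M.freeRun t) := run_succ _ _ _

open Classical in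
/-- The number of letters read up to time `t`. -/
noncomputable def reads : ℕ → ℕ
  | 0 => 0
  | t + 1 => reads t +
      if Halted M.silent (M.freeRun t) ∧ ¬ Halted M.onLetter (M.freeRun t) then 1 else 0

/-- With `t` steps before the endmarker is read, the machine accepts. -/
def AcceptsAt (t : ℕ) : Prop := EndAccepts M.onEnd M.silent M.F (M.freeRun t)

variable {M}

theorem halted_silent_of {c : M.Q × Stack M.Γ} {a : InSym Unit}
    (h : M.δ c.1 (some a) c.2.atTop c.2.scanned ≠ none) : Halted M.silent c := by
  by_contra hc
  exact h (M.deterministic _ _ _ hc a)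

theorem step_eq {f : Trans M.Q M.Γ} {c : M.Q × Stack M.Γ} {q' : M.Q} {op : StackOp M.Γ}
    (h : f c.1 c.2.atTop c.2.scanned = some (q', op)) : step f c = (q', op.run c.2) := by
  unfold step
  rw [h]

theorem step_of_halted {f : Trans M.Q M.Γ} {c : M.Q × Stack M.Γ} (h : Halted f c) :
    step f c = c := by
  unfold step
  rw [show f c.1 c.2.atTop c.2.scanned = none from h]

theorem step_free_of_halted {c : M.Q × Stack M.Γ} (h : Halted M.silent c) :
    step M.free c = step M.onLetter c := by
  have : M.free c.1 c.2.atTop c.2.scanned = M.onLetter c.1 c.2.atTop c.2.scanned := by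
    unfold free
    rw [show M.silent c.1 c.2.atTop c.2.scanned = none from h, Option.none_or]
  unfold step
  rw [this]

theorem step_free_of_not_halted {c : M.Q × Stack M.Γ} (h : ¬ Halted M.silent c) :
    step M.free c = step M.silent c := by
  have : M.free c.1 c.2.atTop c.2.scanned = M.silent c.1 c.2.atTop c.2.scanned := by
    obtain ⟨p, hp⟩ := Option.ne_none_iff_exists'.1 h
    unfold free
    rw [hp, Option.some_or]
  unfold step
  rw [this]

theorem exists_acceptsAt {n : ℕ} (h : M.Accepts (List.replicate n ())) :
    ∃ t, M.reads t = n ∧ M.AcceptsAt t := by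
  obtain ⟨q, S, hr, hhalt, hF⟩ := h
  -- Before the endmarker is read the computation is a piece of the free run; afterwards it consists
  -- of silent steps.
  have key : ∀ c : M.Config, Relation.ReflTransGen M.Step (M.init (List.replicate n ())) c →
      (∃ t k, c.input = tape (List.replicate k ()) ∧ M.reads t + k = n ∧
        M.freeRun t = (c.state, c.stack)) ∨
      (c.input = [] ∧ ∃ t m, M.reads t = n ∧ Halted M.silent (M.freeRun t) ∧
        ¬ Halted M.onEnd (M.freeRun t) ∧
        (step M.silent)^[m] (step M.onEnd (M.freeRun t)) = (c.state, c.stack)) := by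
    intro c hc
    induction hc with
    | refl => exact Or.inl ⟨0, n, rfl, Nat.zero_add n, rfl⟩
    | tail _ hs ih =>
      obtain ⟨q, q', a, v, S, op, htr⟩ := hs
      rcases ih with ⟨t, k, hin, hk, hrun⟩ | ⟨hin, t, m, h₁, h₂, h₃, h₄⟩
      · cases a with
        | none =>
          have hg : M.silent (M.freeRun t).1 (M.freeRun t).2.atTop (M.freeRun t).2.scanned =
              some (q', op) := by rw [hrun]; exact htr
          have hn : ¬ Halted M.silent (M.freeRun t) := by unfold Halted; rw [hg]; simp
          refine Or.inl ⟨t + 1, k, hin, ?_, ?_⟩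
          · rw [reads, if_neg (fun h => hn h.1)]; exact hk
          · rw [freeRun_succ, step_free_of_not_halted hn, step_eq hg, hrun]
        | some a =>
          have hg : Halted M.silent (M.freeRun t) := by
            refine halted_silent_of (a := a) ?_
            rw [hrun]; dsimp only; rw [htr]; simp
          cases k with
          | zero =>
            simp only [tape, List.replicate_zero, List.map_nil, List.nil_append, Option.toList_some,
              List.cons_append, List.cons.injEq] at hin
            obtain ⟨rfl, rfl⟩ := hin
            have he : M.onEnd (M.freeRun t).1 (M.freeRun t).2.atTop (M.freeRun t).2.scanned =
              some (q', op) := by rw [hrun]; exact htr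
            refine Or.inr ⟨rfl, t, 0, by omega, hg, ?_, ?_⟩
            · unfold Halted; rw [he]; simp
            · rw [Function.iterate_zero_apply, step_eq he, hrun]
          | succ k =>
            simp only [tape, List.replicate_succ, List.map_cons, Option.toList_some,
              List.cons_append, List.cons.injEq, List.nil_append] at hin
            obtain ⟨rfl, rfl⟩ := hin
            have he : M.onLetter (M.freeRun t).1 (M.freeRun t).2.atTop (M.freeRun t).2.scanned =
              some (q', op) := by rw [hrun]; exact htr
            refine Or.inl ⟨t + 1, k, rfl, ?_, ?_⟩
            · rw [reads, if_pos ⟨hg, by unfold Halted; rw [he]; simp⟩]; omega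
            · rw [freeRun_succ, step_free_of_halted hg, step_eq he, hrun]
      · obtain ⟨ha, rfl⟩ := List.append_eq_nil_iff.1 hin
        obtain rfl : a = none := by simpa using ha
        refine Or.inr ⟨rfl, t, m + 1, h₁, h₂, h₃, ?_⟩
        rw [Function.iterate_succ_apply', h₄]
        exact step_eq (f := M.silent) (c := (q, S)) htr
  rcases key _ hr with ⟨t, k, hin, -⟩ | ⟨-, t, m, h₁, h₂, h₃, h₄⟩
  · simp [tape] at hin
  · refine ⟨t, h₁, h₂, h₃, m, ?_⟩
    unfold AcceptsIn
    rw [h₄]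
    exact ⟨hhalt, hF⟩

theorem reaches_freeRun {n : ℕ} (t k : ℕ) (h : M.reads t + k = n) :
    Relation.ReflTransGen M.Step (M.init (List.replicate n ()))
      ⟨(M.freeRun t).1, tape (List.replicate k ()), (M.freeRun t).2⟩ := by
  induction t generalizing k with
  | zero =>
    obtain rfl : k = n := by simpa [reads] using h
    exact Relation.ReflTransGen.refl
  | succ t ih =>
    rw [reads] at h
    rw [freeRun_succ]
    by_cases hg : Halted M.silent (M.freeRun t)
    · rw [step_free_of_halted hg]
      by_cases hl : Halted M.onLetter (M.freeRun t)
      · rw [if_neg (by tauto)] at h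
        rw [step_of_halted hl]
        exact ih k h
      · rw [if_pos ⟨hg, hl⟩] at h
        obtain ⟨⟨q', op⟩, hp⟩ := Option.ne_none_iff_exists'.1 hl
        rw [step_eq hp]
        exact (ih (k + 1) (by omega)).tail
          (Step.mk _ q' (some (.letter ())) (tape (List.replicate k ())) _ op hp)
    · rw [if_neg (by tauto)] at h
      rw [step_free_of_not_halted hg]
      obtain ⟨⟨q', op⟩, hp⟩ := Option.ne_none_iff_exists'.1 hg
      rw [step_eq hp]
      exact (ih k h).tail (Step.mk _ q' none (tape (List.replicate k ())) _ op hp)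

theorem accepts_of_acceptsAt {t : ℕ} (h : M.AcceptsAt t) :
    M.Accepts (List.replicate (M.reads t) ()) := by
  obtain ⟨-, he, n, hhalt, hF⟩ := h
  obtain ⟨⟨q', op⟩, hp⟩ := Option.ne_none_iff_exists'.1 he
  have h₀ := (reaches_freeRun (n := M.reads t) t 0 rfl).tail
    (Step.mk _ q' (some .endmarker) [] _ op hp)
  have h₁ : ∀ n, Relation.ReflTransGen M.Step (M.init (List.replicate (M.reads t) ()))
      ⟨((step M.silent)^[n] (step M.onEnd (M.freeRun t))).1, [],
        ((step M.silent)^[n] (step M.onEnd (M.freeRun t))).2⟩ := by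
    intro n
    induction n with
    | zero => rw [Function.iterate_zero_apply, step_eq hp]; exact h₀
    | succ n ih =>
      rw [Function.iterate_succ_apply']
      by_cases hg : Halted M.silent ((step M.silent)^[n] (step M.onEnd (M.freeRun t)))
      · rw [step_of_halted hg]; exact ih
      · obtain ⟨⟨q', op⟩, hp⟩ := Option.ne_none_iff_exists'.1 hg
        rw [step_eq hp]
        exact ih.tail (Step.mk _ q' none [] _ op hp)
  exact ⟨_, _, h₁ n, hhalt, hF⟩

theorem reads_mono : Monotone M.reads :=
  monotone_nat_of_le_succ fun t => by rw [reads]; exact Nat.le_add_right _ _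

theorem reads_le (t : ℕ) : M.reads t ≤ t := by
  induction t with
  | zero => exact le_rfl
  | succ t ih => rw [reads]; split_ifs <;> omega

end DSA

/-! ### The cubes are too sparse for a stack automaton -/

theorem cubes_not_periodic {n ρ m : ℕ} (hρ : 0 < ρ) (hn : ρ ≤ n) (h : n ^ 3 + ρ = m ^ 3) :
    False := by
  have h₁ : n < m := lt_of_pow_lt_pow_left₀ 3 (Nat.zero_le m) (by omega)
  have h₂ : (n + 1) ^ 3 ≤ m ^ 3 := Nat.pow_le_pow_left h₁ 3
  have h₃ : (n + 1) ^ 3 = n ^ 3 + 3 * n ^ 2 + 3 * n + 1 := by ring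
  omega

theorem replicate_mem_cubeLanguage {n : ℕ} :
    List.replicate n () ∈ cubeLanguage ↔ ∃ m, n = m ^ 3 := by
  constructor
  · rintro ⟨m, h⟩
    exact ⟨m, by simpa using congrArg List.length h⟩
  · rintro ⟨m, rfl⟩
    exact ⟨m, rfl⟩

open StackRun in
theorem not_isDSALanguage_cubeLanguage : ¬ IsDSALanguage cubeLanguage := by
  rintro ⟨M, hM⟩
  have hacc : ∀ n, M.Accepts (List.replicate n ()) ↔ ∃ m, n = m ^ 3 := fun n => by
    rw [← replicate_mem_cubeLanguage, ← hM]
    rfl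
  have hcube : ∀ t, M.AcceptsAt t → ∃ m, M.reads t = m ^ 3 := fun t ht =>
    (hacc _).1 (DSA.accepts_of_acceptsAt ht)
  have hex : ∀ m, ∃ t, M.reads t = m ^ 3 ∧ M.AcceptsAt t := fun m =>
    DSA.exists_acceptsAt ((hacc _).2 ⟨m, rfl⟩)
  have hle : ∀ m, m ≤ m ^ 3 := fun m => Nat.le_self_pow (by norm_num) m
  by_cases hinj : Function.Injective M.freeRun
  · have := M.finite_Q
    have := M.finite_Γ
    obtain ⟨L⟩ := nonempty_loop M.legal_free M.silent M.F hinj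
    obtain ⟨C, a, ha, hA, hC⟩ := L.exists_slow (e := M.onEnd) M.legal_free M.legal_onEnd
      M.legal_silent hinj fun N => by
        obtain ⟨t, ht, hA⟩ := hex N
        exact ⟨t, (hle N).trans (ht ▸ DSA.reads_le t), hA⟩
    choose b hb using fun m => hcube (a m) (hA m)
    have hreads : ∀ m, M.reads (a m) < M.reads (a (m + 1)) := by
      intro m
      have hg : Halted M.silent (M.freeRun (a m)) := (hA m).1
      -- Otherwise the free run would stand still here, against injectivity. So a letter is read
      -- right after each accepting moment, and different accepting moments have different numbers
      -- of letters.
      have hl : ¬ Halted M.onLetter (M.freeRun (a m)) := fun hl => by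
        have h := M.freeRun_succ (a m)
        rw [DSA.step_free_of_halted hg, DSA.step_of_halted hl] at h
        exact absurd (hinj h) (by omega)
      refine lt_of_lt_of_le ?_ (DSA.reads_mono (show a m + 1 ≤ a (m + 1) from
        ha (Nat.lt_succ_self m)))
      rw [DSA.reads, if_pos ⟨hg, hl⟩]
      exact Nat.lt_succ_self _
    have hbmono : StrictMono b := strictMono_nat_of_lt_succ fun m => by
      have := hreads m
      rw [hb, hb] at this
      exact lt_of_pow_lt_pow_left₀ 3 (Nat.zero_le _) this
    -- At `m = 4 * C + 1` the cubic lower bound `m ^ 3` already exceeds the quadratic upper bound `C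
    -- * (m + 1) ^ 2`.
    have h₁ := (Nat.pow_le_pow_left (hbmono.id_le (4 * C + 1)) 3).trans
      ((hb _).symm.le.trans ((DSA.reads_le _).trans (hC (4 * C + 1))))
    simp only [id] at h₁
    nlinarith [Nat.zero_le (C ^ 2), Nat.zero_le (C ^ 3)]
  · obtain ⟨s, p, hp, hsp⟩ : ∃ s p, 0 < p ∧ M.freeRun (s + p) = M.freeRun s := by
      rw [Function.Injective] at hinj
      push Not at hinj
      obtain ⟨i, j, hij, hne⟩ := hinj
      rcases Nat.lt_or_gt_of_ne hne with h | h
      · exact ⟨i, j - i, by omega, by rw [hij]; congr 1; omega⟩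
      · exact ⟨j, i - j, by omega, by rw [← hij]; congr 1; omega⟩
    have hper : ∀ t ≥ s, M.freeRun (t + p) = M.freeRun t := by
      intro t ht
      induction t, ht using Nat.le_induction with
      | base => exact hsp
      | succ t _ ih => rw [Nat.add_right_comm, M.freeRun_succ, ih, ← M.freeRun_succ]
    obtain ⟨ρ, hρ⟩ := Nat.exists_eq_add_of_le (DSA.reads_mono (M := M) (Nat.le_add_right s p))
    have hreads : ∀ t ≥ s, M.reads (t + p) = M.reads t + ρ := by
      intro t ht
      induction t, ht using Nat.le_induction with
      | base => exact hρ
      | succ t ht ih =>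
        rw [Nat.add_right_comm, DSA.reads, ih, hper t ht, DSA.reads]
        omega
    -- This cube is large enough to be read only after the period has begun, and its root is larger
    -- than the increment `ρ`.
    obtain ⟨t, ht, hA⟩ := hex (M.reads s + ρ + 1)
    have hst : s ≤ t := by
      by_contra hc
      have := DSA.reads_mono (M := M) (not_le.1 hc).le
      have := hle (M.reads s + ρ + 1)
      omega
    -- If no letter is read in a period, the number of letters read stays bounded; otherwise a large
    -- cube plus `ρ` would again be a cube.
    rcases Nat.eq_zero_or_pos ρ with rfl | h0
    · have hconst : ∀ j, M.reads (s + j * p) = M.reads s := by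
        intro j
        induction j with
        | zero => simp
        | succ j ih => rw [add_mul, one_mul, ← Nat.add_assoc, hreads _ (by omega), ih]; rfl
      have := DSA.reads_mono (M := M) (show t ≤ s + t * p by nlinarith)
      have := hconst t
      have := hle (M.reads s + 0 + 1)
      omega
    · have hA' : M.AcceptsAt (t + p) := by
        unfold DSA.AcceptsAt
        rw [hper t hst]
        exact hA
      obtain ⟨m, hm⟩ := hcube _ hA'
      rw [hreads t hst, ht] at hm
      exact cubes_not_periodic h0 (by omega) hm

end TreeStorage

/-! ### A real-time tree-walking-storage automaton for the cubes -/

namespace TreeStorage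

namespace CubeMachine

/-- The three ways of walking: extend the right branch of the current node of the left spine,
return to the spine and go on to its next node, or return along the spine to the root. -/
inductive Mode where
  | extend
  | advance
  | back
deriving DecidableEq

/-- The states. Each move of the tree pointer takes three steps `first`, `second`, `move`. -/
inductive State where
  | start
  | done
  | first (m : Mode)
  | second (m : Mode)
  | move (m : Mode)
deriving DecidableEq

instance : Finite Mode :=
  Finite.of_surjective (fun i : Fin 3 => (![.extend, .advance, .back] : Fin 3 → Mode) i) <| by
    rintro (_ | _ | _)
    exacts [⟨0, rfl⟩, ⟨1, rfl⟩, ⟨2, rfl⟩]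

instance : Finite State :=
  Finite.of_surjective (fun p : Mode ⊕ Mode ⊕ Mode ⊕ Bool => match p with
    | .inl m => State.first m
    | .inr (.inl m) => .second m
    | .inr (.inr (.inl m)) => .move m
    | .inr (.inr (.inr b)) => if b then .start else .done) <| by
    rintro (_ | _ | m | m | m)
    exacts [⟨.inr (.inr (.inr true)), rfl⟩, ⟨.inr (.inr (.inr false)), rfl⟩, ⟨.inl m, rfl⟩,
      ⟨.inr (.inl m), rfl⟩, ⟨.inr (.inr (.inl m)), rfl⟩]

/-- The move in a given mode at a node of a given type. -/
def moveAt : Mode → NodeType → State × TreeOp Unit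
  | .extend, t => if t.hasR = true then (.first .extend, .down .r)
      else (.first .advance, .push () .r)
  | .advance, t => if t.pos = some .r then (.first .advance, .up)
      else if t.hasL = true then (.first .extend, .down .l) else (.first .back, .push () .l)
  | .back, t => if t.pos = none then (.first .back, .stay) else (.first .back, .up)

/-- The step that reads a letter. -/
def onLetter : State → NodeType → State × TreeOp Unit
  | .start, _ => (.first .back, .stay)
  | .done, _ => (.done, .stay)
  | .first m, t => if m = .back ∧ t.pos = none then (.first .advance, .stay) else (.second m, .stay)
  | .second m, _ => (.move m, .stay)
  | .move m, t => moveAt m t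

/-- The machine accepts initially and whenever it has returned to the root. -/
def Final (q : State) (t : NodeType) : Prop := q = .start ∨ q = .first .back ∧ t.pos = none

theorem allowed_moveAt (m : Mode) (t : NodeType) : (moveAt m t).2.Allowed t := by
  cases m <;> simp only [moveAt] <;> split_ifs <;>
    simp_all [TreeOp.Allowed, NodeType.has]

theorem allowed_onLetter (q : State) (t : NodeType) : (onLetter q t).2.Allowed t := by
  cases q with
  | first m => simp only [onLetter]; split_ifs <;> trivial
  | move m => exact allowed_moveAt m t
  | _ => trivial

open Classical in
/-- A real-time tree-walking-storage automaton for the cubes. -/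
noncomputable abbrev machine : TWSDA Unit where
  Q := State
  Γ := Unit
  finite_Q := inferInstance
  finite_Γ := inferInstance
  δ q a t _ := match a with
    | none => none
    | some (.letter _) => some (onLetter q t)
    | some .endmarker => if Final q t then some (.done, .stay) else none
  q₀ := .start
  F := {.done}
  deterministic := fun _ _ _ h => absurd rfl h
  allowed := by
    intro q a t x q' op h
    rcases a with _ | _ | _
    · exact absurd h (by simp)
    · have := allowed_onLetter q t
      rw [Option.some.inj h] at this
      exact this
    · dsimp only at h
      split_ifs at h
      obtain rfl : TreeOp.stay = op := (Prod.mk.inj (Option.some.inj h)).2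
      trivial

/-- State, tree and tree pointer. -/
abbrev Conf := State × Tree Unit × Node

/-- The step that reads a letter, on configurations. -/
def step (c : Conf) : Conf :=
  ((onLetter c.1 (c.2.1.nodeType c.2.2)).1, (onLetter c.1 (c.2.1.nodeType c.2.2)).2.run c.2.1 c.2.2)

/-- The configuration after `n` letters. -/
def run (n : ℕ) : Conf := step^[n] (.start, Tree.init Unit, [])

/-- The machine accepts if the endmarker is read in this configuration. -/
def AcceptsAt (c : Conf) : Prop := Final c.1 (c.2.1.nodeType c.2.2)

theorem run_succ (n : ℕ) : run (n + 1) = step (run n) := Function.iterate_succ_apply' _ _ _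

theorem acceptsAt_of_accepts {n : ℕ} (h : machine.Accepts (List.replicate n ())) :
    AcceptsAt (run n) := by
  obtain ⟨q, T, P, x, hr, -, -, -⟩ := h
  have key : ∀ c : machine.Config,
      Relation.ReflTransGen machine.Step (machine.init (List.replicate n ())) c →
      (∃ t k, c.input = tape (List.replicate k ()) ∧ t + k = n ∧
        run t = (c.state, c.tree, c.ptr)) ∨ (c.input = [] ∧ AcceptsAt (run n)) := by
    intro c hc
    induction hc with
    | refl => exact Or.inl ⟨0, n, rfl, Nat.zero_add n, rfl⟩
    | tail _ hs ih =>
      obtain ⟨q, q', a, v, T, P, x, op, hx, htr⟩ := hs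
      rcases ih with ⟨t, k, hin, hk, hrun⟩ | ⟨hin, hacc⟩
      · rcases a with _ | _ | _
        · exact absurd htr (by simp)
        · cases k with
          | zero => simp [tape] at hin
          | succ k =>
            simp only [tape, List.replicate_succ, List.map_cons, Option.toList_some,
              List.cons_append, List.cons.injEq, List.nil_append] at hin
            refine Or.inl ⟨t + 1, k, hin.2, by omega, ?_⟩
            have htr' : onLetter q (T.nodeType P) = (q', op) := Option.some.inj htr
            rw [run_succ, hrun, step]
            dsimp only
            rw [htr']
        · cases k with
          | zero =>
            simp only [tape, List.replicate_zero, List.map_nil, List.nil_append, Option.toList_some,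
              List.cons_append, List.cons.injEq] at hin
            refine Or.inr ⟨hin.2, ?_⟩
            obtain rfl : t = n := by omega
            by_contra hc
            have hc' : ¬ Final q (T.nodeType P) := by rw [hrun] at hc; exact hc
            dsimp only at htr
            rw [if_neg hc'] at htr
            exact absurd htr (by simp)
          | succ k => simp [tape, List.replicate_succ] at hin
      · obtain ⟨ha, rfl⟩ := List.append_eq_nil_iff.1 hin
        exact Or.inr ⟨rfl, hacc⟩
  rcases key _ hr with ⟨t, k, hin, -⟩ | ⟨-, h⟩
  · simp [tape] at hin
  · exact h

theorem accepts_of_acceptsAt {n : ℕ} (hlab : ∀ t ≤ n, ((run t).2.1 (run t).2.2).isSome)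
    (h : AcceptsAt (run n)) : machine.Accepts (List.replicate n ()) := by
  have key : ∀ t k, t + k = n →
      Relation.ReflTransGen machine.Step (machine.init (List.replicate n ()))
        ⟨(run t).1, tape (List.replicate k ()), (run t).2.1, (run t).2.2⟩ := by
    intro t
    induction t with
    | zero =>
      intro k hk
      obtain rfl : k = n := by omega
      exact Relation.ReflTransGen.refl
    | succ t ih =>
      intro k hk
      obtain ⟨x, hx⟩ := Option.isSome_iff_exists.1 (hlab t (by omega))
      refine (ih (k + 1) (by omega)).tail ?_
      rw [run_succ]
      exact TWSDA.Step.mk (M := machine) _ _ (some (.letter ())) (tape (List.replicate k ())) _ _ x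
        (onLetter (run t).1 ((run t).2.1.nodeType (run t).2.2)).2 hx rfl
  obtain ⟨x, hx⟩ := Option.isSome_iff_exists.1 (hlab n le_rfl)
  refine ⟨.done, (run n).2.1, (run n).2.2, x, (key n 0 rfl).tail ?_, hx, rfl, rfl⟩
  exact TWSDA.Step.mk (M := machine) _ _ (some .endmarker) [] _ _ x .stay hx (if_pos h)

/-- `k` steps lead from `c` to `c'`; the machine would not accept before the last step. -/
def Walk (k : ℕ) (c c' : Conf) : Prop :=
  step^[k] c = c' ∧
    ∀ i < k, ¬ AcceptsAt (step^[i] c) ∧ ((step^[i] c).2.1 (step^[i] c).2.2).isSome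

theorem Walk.trans {k l : ℕ} {c c' c'' : Conf} (h : Walk k c c') (h' : Walk l c' c'') :
    Walk (k + l) c c'' := by
  obtain ⟨rfl, h₁⟩ := h
  obtain ⟨rfl, h₂⟩ := h'
  refine ⟨by rw [Nat.add_comm, Function.iterate_add_apply], fun i hi => ?_⟩
  rcases lt_or_ge i k with hik | hik
  · exact h₁ i hik
  · have := h₂ (i - k) (by omega)
    rwa [← Function.iterate_add_apply, Nat.sub_add_cancel hik] at this

theorem Walk.zero (c : Conf) : Walk 0 c c := ⟨rfl, fun i hi => absurd hi (Nat.not_lt_zero i)⟩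

/-- The excluded case is the arrival at the root, where the machine accepts and a single letter
starts the next tour. -/
theorem walk_move {m : Mode} {T : Tree Unit} {P : Node} (hP : (T P).isSome)
    (h : ¬ (m = .back ∧ P = [])) : Walk 3 (.first m, T, P)
      ((moveAt m (T.nodeType P)).1, (moveAt m (T.nodeType P)).2.run T P) := by
  have h' : ¬ (m = .back ∧ (T.nodeType P).pos = none) := by
    simpa [Tree.nodeType] using h
  have h₁ : step (.first m, T, P) = (.second m, T, P) := by
    simp only [step, onLetter, if_neg h']
    rfl
  refine ⟨?_, fun i hi => ?_⟩
  · rw [Function.iterate_succ_apply, h₁]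
    rfl
  · have : i = 0 ∨ i = 1 ∨ i = 2 := by omega
    rcases this with rfl | rfl | rfl
    · refine ⟨?_, hP⟩
      simpa [AcceptsAt, Final] using h'
    · rw [Function.iterate_one, h₁]
      exact ⟨by simp [AcceptsAt, Final], hP⟩
    · rw [Function.iterate_succ_apply, h₁]
      exact ⟨by simp [AcceptsAt, Final, step, onLetter], hP⟩

/-- The `j`-th node on the right branch at the `i`-th node of the left spine. -/
def node (i j : ℕ) : Node := List.replicate j .r ++ List.replicate i .l

theorem node_inj {i j i' j' : ℕ} (h : node i j = node i' j') : i = i' ∧ j = j' := by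
  have h₁ := congrArg (List.count .l) h
  have h₂ := congrArg (List.count .r) h
  simp [node, List.count_replicate] at h₁ h₂
  exact ⟨h₁, h₂⟩

theorem node_succ_right (i j : ℕ) : .r :: node i j = node i (j + 1) := rfl

theorem node_succ_left (i : ℕ) : .l :: node i 0 = node (i + 1) 0 := rfl

open Classical in
/-- The tree with a left spine of length `n` and right branches of lengths `b 1, …, b n`. -/
noncomputable def comb (n : ℕ) (b : ℕ → ℕ) : Tree Unit := fun P =>
  if P = [] then some ⊥
  else if ∃ i j, 1 ≤ i ∧ i ≤ n ∧ j ≤ b i ∧ P = node i j then some (() : Unit) else none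

theorem isSome_comb {n : ℕ} {b : ℕ → ℕ} {P : Node} : (comb n b P).isSome ↔
    P = [] ∨ ∃ i j, 1 ≤ i ∧ i ≤ n ∧ j ≤ b i ∧ P = node i j := by
  unfold comb
  split_ifs <;> simp_all

theorem comb_congr {n : ℕ} {b b' : ℕ → ℕ} (h : ∀ i, 1 ≤ i → i ≤ n → b i = b' i) :
    comb n b = comb n b' := by
  funext P
  unfold comb
  have : (∃ i j, 1 ≤ i ∧ i ≤ n ∧ j ≤ b i ∧ P = node i j) ↔
      ∃ i j, 1 ≤ i ∧ i ≤ n ∧ j ≤ b' i ∧ P = node i j := by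
    constructor <;> rintro ⟨i, j, h₁, h₂, h₃, h₄⟩
    · exact ⟨i, j, h₁, h₂, h i h₁ h₂ ▸ h₃, h₄⟩
    · exact ⟨i, j, h₁, h₂, (h i h₁ h₂).symm ▸ h₃, h₄⟩
  classical
  exact if_congr Iff.rfl rfl (if_congr this rfl rfl)

theorem comb_zero (b : ℕ → ℕ) : comb 0 b = Tree.init Unit := by
  funext P
  unfold comb Tree.init
  split_ifs with h₁ h₂
  · rfl
  · obtain ⟨i, j, h₃, h₄, -⟩ := h₂
    omega
  · rfl

theorem node_ne_nil {i j : ℕ} (hi : 1 ≤ i) : node i j ≠ [] := by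
  intro h
  have := (node_inj (i' := 0) (j' := 0) h).1
  omega

theorem isSome_comb_node {n i j : ℕ} {b : ℕ → ℕ} (hi : 1 ≤ i) :
    (comb n b (node i j)).isSome ↔ i ≤ n ∧ j ≤ b i := by
  rw [isSome_comb]
  constructor
  · rintro (h | ⟨i', j', h₁, h₂, h₃, h₄⟩)
    · exact absurd h (node_ne_nil hi)
    · obtain ⟨rfl, rfl⟩ := node_inj h₄
      exact ⟨h₂, h₃⟩
  · rintro ⟨h₁, h₂⟩
    exact Or.inr ⟨i, j, hi, h₁, h₂, rfl⟩

theorem isSome_comb_spine {n i : ℕ} {b : ℕ → ℕ} (hi : i ≤ n) :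
    (comb n b (node i 0)).isSome := by
  rcases Nat.eq_zero_or_pos i with rfl | h
  · exact isSome_comb.2 (Or.inl rfl)
  · exact (isSome_comb_node h).2 ⟨hi, Nat.zero_le _⟩

theorem update_comb {n n' i j : ℕ} {b b' : ℕ → ℕ} (hi : 1 ≤ i)
    (h : ∀ i' j', 1 ≤ i' → ((i' ≤ n' ∧ j' ≤ b' i') ↔ (i' = i ∧ j' = j ∨ i' ≤ n ∧ j' ≤ b i'))) :
    Function.update (comb n b) (node i j) (some (() : Unit)) = comb n' b' := by
  funext P
  rw [Function.update_apply]
  unfold comb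
  by_cases hP : P = node i j
  · subst hP
    rw [if_pos rfl, if_neg (node_ne_nil hi), if_pos]
    obtain ⟨h₁, h₂⟩ := (h i j hi).2 (Or.inl ⟨rfl, rfl⟩)
    exact ⟨i, j, hi, h₁, h₂, rfl⟩
  · rw [if_neg hP]
    have : (∃ i j, 1 ≤ i ∧ i ≤ n ∧ j ≤ b i ∧ P = node i j) ↔
        ∃ i j, 1 ≤ i ∧ i ≤ n' ∧ j ≤ b' i ∧ P = node i j := by
      constructor
      · rintro ⟨i', j', h₁, h₂, h₃, h₄⟩
        obtain ⟨h₅, h₆⟩ := (h i' j' h₁).2 (Or.inr ⟨h₂, h₃⟩)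
        exact ⟨i', j', h₁, h₅, h₆, h₄⟩
      · rintro ⟨i', j', h₁, h₂, h₃, rfl⟩
        rcases (h i' j' h₁).1 ⟨h₂, h₃⟩ with ⟨rfl, rfl⟩ | ⟨h₅, h₆⟩
        · exact absurd rfl hP
        · exact ⟨i', j', h₁, h₅, h₆, rfl⟩
    classical
    exact if_congr Iff.rfl rfl (if_congr this rfl rfl)

/-- There are `d` moves down the rest of the branch and one push, each of three letters. -/
theorem walk_extend {n i : ℕ} {b : ℕ → ℕ} (hi : 1 ≤ i) (hn : i ≤ n) (d : ℕ) :
    ∀ j, j + d = b i → Walk (3 * (d + 1)) (.first .extend, comb n b, node i j)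
      (.first .advance, comb n (Function.update b i (b i + 1)), node i (b i + 1)) := by
  induction d with
  | zero =>
    intro j hj
    have hw := walk_move (m := .extend) (T := comb n b) (P := node i j)
      ((isSome_comb_node hi).2 ⟨hn, by omega⟩) (by simp)
    have hR : ((comb n b).nodeType (node i j)).hasR = false := by
      rw [Tree.nodeType, node_succ_right, ← Bool.not_eq_true, isSome_comb_node hi]
      omega
    simp only [moveAt, hR, Bool.false_eq_true, if_false, TreeOp.run, node_succ_right] at hw
    obtain rfl : j = b i := by omega
    rwa [update_comb (n' := n) (b' := Function.update b i (b i + 1)) hi] at hw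
    intro i' j' h₁
    rcases eq_or_ne i' i with rfl | hne
    · rw [Function.update_self]
      omega
    · rw [Function.update_of_ne hne]
      omega
  | succ d ih =>
    intro j hj
    have hw := walk_move (m := .extend) (T := comb n b) (P := node i j)
      ((isSome_comb_node hi).2 ⟨hn, by omega⟩) (by simp)
    have hR : ((comb n b).nodeType (node i j)).hasR = true := by
      rw [Tree.nodeType, node_succ_right, isSome_comb_node hi]
      omega
    simp only [moveAt, hR, if_true, TreeOp.run, node_succ_right] at hw
    have := hw.trans (ih (j + 1) (by omega))
    rwa [show 3 * (d + 1 + 1) = 3 + 3 * (d + 1) by ring]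

theorem walk_return {n i : ℕ} {b : ℕ → ℕ} (hi : 1 ≤ i) (hn : i ≤ n) (j : ℕ) (hj : j ≤ b i) :
    Walk (3 * j) (.first .advance, comb n b, node i j) (.first .advance, comb n b, node i 0) := by
  induction j with
  | zero => exact Walk.zero _
  | succ j ih =>
    have hw := walk_move (m := .advance) (T := comb n b) (P := node i (j + 1))
      ((isSome_comb_node hi).2 ⟨hn, hj⟩) (by simp)
    have hp : ((comb n b).nodeType (node i (j + 1))).pos = some .r := rfl
    simp only [moveAt, hp, if_true, TreeOp.run] at hw
    have := hw.trans (ih (by omega))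
    rwa [show 3 * (j + 1) = 3 + 3 * j by ring]

theorem pos_spine_ne {T : Tree Unit} (i : ℕ) : (T.nodeType (node i 0)).pos ≠ some .r := by
  cases i <;> simp [Tree.nodeType, node, List.replicate_succ]

theorem walk_next {n i : ℕ} {b : ℕ → ℕ} (hi : i < n) :
    Walk 3 (.first .advance, comb n b, node i 0) (.first .extend, comb n b, node (i + 1) 0) := by
  have hw := walk_move (m := .advance) (T := comb n b) (P := node i 0)
    (isSome_comb_spine hi.le) (by simp)
  have hL : ((comb n b).nodeType (node i 0)).hasL = true := isSome_comb_spine (i := i + 1) hi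
  simpa only [moveAt, if_neg (pos_spine_ne i), hL, if_true, TreeOp.run, node_succ_left] using hw

theorem walk_grow {n : ℕ} {b : ℕ → ℕ} (hb : b (n + 1) = 0) :
    Walk 3 (.first .advance, comb n b, node n 0)
      (.first .back, comb (n + 1) b, node (n + 1) 0) := by
  have hw := walk_move (m := .advance) (T := comb n b) (P := node n 0)
    (isSome_comb_spine le_rfl) (by simp)
  have hL : ((comb n b).nodeType (node n 0)).hasL = false := by
    rw [Tree.nodeType, node_succ_left, ← Bool.not_eq_true, isSome_comb_node (by omega)]
    omega
  simp only [moveAt, if_neg (pos_spine_ne n), hL, Bool.false_eq_true, if_false, TreeOp.run,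
    node_succ_left] at hw
  rwa [update_comb (n' := n + 1) (b' := b) (by omega)] at hw
  intro i' j' h₁
  rcases eq_or_ne i' (n + 1) with rfl | hne
  · rw [hb]; omega
  · rw [show i' ≤ n + 1 ↔ i' ≤ n by omega]; simp [hne]

theorem walk_back {n : ℕ} {b : ℕ → ℕ} (i : ℕ) (hi : i ≤ n) :
    Walk (3 * i) (.first .back, comb n b, node i 0) (.first .back, comb n b, []) := by
  induction i with
  | zero => exact Walk.zero _
  | succ i ih =>
    have hw := walk_move (m := .back) (T := comb n b) (P := node (i + 1) 0)
      (isSome_comb_spine hi) (by simp [node, List.replicate_succ])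
    have hp : ((comb n b).nodeType (node (i + 1) 0)).pos ≠ none := by
      simp [Tree.nodeType, node, List.replicate_succ]
    simp only [moveAt, if_neg hp, TreeOp.run] at hw
    have := hw.trans (ih (by omega))
    rwa [show 3 * (i + 1) = 3 + 3 * i by ring]

/-- The lengths of the branches when the first `i` of them have been extended. -/
def lengths (n i k : ℕ) : ℕ := if k ≤ i then n + 1 - k else n - k

/-- With `d` spine nodes left, the next branch grows to length `d`. Reaching it, extending it and
returning take `3 + 3 * d + 3 * d` letters; summing this down to one remaining node gives `3 * d ^ 2
+ 6 * d`. -/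
theorem walk_spine {n : ℕ} (d : ℕ) : ∀ i, i + d = n →
    Walk (3 * d ^ 2 + 6 * d) (.first .advance, comb n (lengths n i), node i 0)
      (.first .advance, comb n (lengths n n), node n 0) := by
  induction d with
  | zero => rintro i rfl; exact Walk.zero _
  | succ d ih =>
    intro i hi
    have hl : lengths n i (i + 1) = d := by unfold lengths; rw [if_neg (by omega)]; omega
    have hu : Function.update (lengths n i) (i + 1) (lengths n i (i + 1) + 1) =
        lengths n (i + 1) := by
      funext k
      rw [Function.update_apply, hl]
      unfold lengths
      split_ifs <;> omega
    have h₁ := walk_next (n := n) (i := i) (b := lengths n i) (by omega)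
    have h₂ := walk_extend (n := n) (i := i + 1) (b := lengths n i) (by omega) (by omega) d 0
      (by omega)
    rw [hu, hl] at h₂
    have h₃ := walk_return (n := n) (i := i + 1) (b := lengths n (i + 1)) (by omega) (by omega)
      (d + 1) (by rw [← hu, Function.update_self, hl])
    have := ((h₁.trans h₂).trans h₃).trans (ih (i + 1) (by omega))
    rwa [show 3 * (d + 1) ^ 2 + 6 * (d + 1) =
      3 + 3 * (d + 1) + 3 * (d + 1) + (3 * d ^ 2 + 6 * d) by ring]

/-- The configuration at the root after the tree has been extended to size `n`. -/
noncomputable def atRoot (n : ℕ) : Conf := (.first .back, comb n (lengths n 0), [])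

theorem step_atRoot (n : ℕ) : step (atRoot n) = (.first .advance, comb n (lengths n 0), []) := rfl

/-- The tour of the spine, the new spine node and the way back take `3 * n ^ 2 + 6 * n`, `3` and `3
* (n + 1)` letters. Together with the letter read at the root this is the difference of the cubes of
`n + 2` and `n + 1`. -/
theorem walk_phase (n : ℕ) :
    Walk (3 * (n + 1) ^ 2 + 3 * (n + 1)) (step (atRoot n)) (atRoot (n + 1)) := by
  have h₁ := walk_spine (n := n) n 0 (by omega)
  have h₂ := walk_grow (n := n) (b := lengths n n) (by
    unfold lengths; rw [if_neg (by omega)]; omega)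
  have h₃ := walk_back (n := n + 1) (b := lengths n n) (n + 1) le_rfl
  have := (h₁.trans h₂).trans h₃
  -- All old branches extended, plus an empty one at the new spine node, is the initial shape for
  -- size `n + 1`.
  rw [comb_congr (n := n + 1) (b := lengths n n) (b' := lengths (n + 1) 0)] at this
  · rw [step_atRoot, show 3 * (n + 1) ^ 2 + 3 * (n + 1) = 3 * n ^ 2 + 6 * n + 3 + 3 * (n + 1) by ring]
    exact this
  · intro i h₁ h₂
    unfold lengths
    split_ifs <;> omega

theorem run_cube (n : ℕ) : run ((n + 1) ^ 3) = atRoot n := by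
  induction n with
  | zero =>
    rw [atRoot, comb_zero]
    rfl
  | succ n ih =>
    have h := (walk_phase n).1
    rw [← ih, ← run_succ] at h
    rw [show (n + 1 + 1) ^ 3 = 3 * (n + 1) ^ 2 + 3 * (n + 1) + ((n + 1) ^ 3 + 1) by ring, ← h]
    simp only [run, Function.iterate_add_apply]

theorem acceptsAt_run {n : ℕ} : (AcceptsAt (run n) ↔ ∃ m, n = m ^ 3) ∧
    ((run n).2.1 (run n).2.2).isSome := by
  rcases Nat.eq_zero_or_pos n with rfl | hpos
  · exact ⟨⟨fun _ => ⟨0, rfl⟩, fun _ => Or.inl rfl⟩, rfl⟩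
  obtain ⟨m, hm₁, hm₂⟩ : ∃ m, (m + 1) ^ 3 ≤ n ∧ n < (m + 2) ^ 3 := by
    have hex : ∃ m, n < (m + 2) ^ 3 :=
      ⟨n, (Nat.lt_add_of_pos_right two_pos).trans_le (Nat.le_self_pow (by norm_num) _)⟩
    refine ⟨Nat.find hex, ?_, Nat.find_spec hex⟩
    rcases h : Nat.find hex with _ | k
    · simp only [Nat.zero_add, one_pow]; omega
    · exact not_lt.1 (Nat.find_min hex (m := k) (by omega))
  obtain ⟨r, rfl⟩ := Nat.exists_eq_add_of_le hm₁
  cases r with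
  | zero =>
    rw [Nat.add_zero, run_cube]
    exact ⟨⟨fun _ => ⟨m + 1, rfl⟩, fun _ => Or.inr ⟨rfl, rfl⟩⟩,
      isSome_comb_spine (b := lengths m 0) (Nat.zero_le m)⟩
  | succ r =>
    have hr : r < 3 * (m + 1) ^ 2 + 3 * (m + 1) := by
      have : (m + 2) ^ 3 = (m + 1) ^ 3 + (3 * (m + 1) ^ 2 + 3 * (m + 1)) + 1 := by ring
      omega
    have hrun : run ((m + 1) ^ 3 + (r + 1)) = step^[r] (step (atRoot m)) := by
      rw [← run_cube m, ← run_succ, run, run, ← Function.iterate_add_apply]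
      congr 1
      omega
    -- Strictly between two consecutive positive cubes the machine is inside a tour, where `Walk`
    -- excludes acceptance.
    obtain ⟨h₁, h₂⟩ := (walk_phase m).2 r hr
    rw [hrun]
    refine ⟨⟨fun h => absurd h h₁, ?_⟩, h₂⟩
    rintro ⟨k, hk⟩
    have hlo : m + 1 < k := lt_of_pow_lt_pow_left₀ 3 (Nat.zero_le k) (by omega)
    have hhi : k < m + 2 := lt_of_pow_lt_pow_left₀ 3 (Nat.zero_le _) (by omega)
    omega

theorem language_machine : machine.language = cubeLanguage := by
  ext w
  obtain ⟨n, rfl⟩ : ∃ n, w = List.replicate n () := ⟨w.length, by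
    rw [List.eq_replicate_iff]; exact ⟨rfl, fun _ _ => rfl⟩⟩
  rw [replicate_mem_cubeLanguage, ← acceptsAt_run.1]
  exact ⟨acceptsAt_of_accepts, accepts_of_acceptsAt fun t _ => acceptsAt_run.2⟩

end CubeMachine

theorem isRealTimeTWSDALanguage_cubeLanguage : IsRealTimeTWSDALanguage cubeLanguage :=
  ⟨CubeMachine.machine, fun _ _ _ => rfl, CubeMachine.language_machine⟩

end TreeStorage

theorem mainTheorem6 :
    TreeStorage.IsRealTimeTWSDALanguage TreeStorage.cubeLanguage ∧
      ¬ TreeStorage.IsDSALanguage TreeStorage.cubeLanguage :=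
  ⟨TreeStorage.isRealTimeTWSDALanguage_cubeLanguage, TreeStorage.not_isDSALanguage_cubeLanguage⟩
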